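/- Fix $R>2$ and let $\psi_R\in C^\infty(\mathbb R^2,[0,1])$ be a cutoff function with $\psi_R(\xi)=0$ for $|\xi|\le R$ and $\psi_R(\xi)=1$ for $|\xi|\ge R+1$. For $u,\xi\in\mathbb C\cong\mathbb R^2$, $\xi\ne0$, let $$\widetilde S(u,\xi)=(\xi^3+\bar\xi^3)\Bigl(1-\frac{3}{\xi\bar\xi}\Bigr)+\frac12(\bar u\,\xi+u\,\bar\xi)$$ be the phase of the linearized Novikov–Veselov equation at energy $E=1$. Let $0\le\alpha<1$ and $0<\varepsilon<\frac{1-\alpha}{3}$. Then for all $t>0$ and $u\in\mathbb C$ the oscillatory integral $$I_R(t,u)=\int_{\mathbb C}|\xi|^{\alpha}\,\psi_R(\xi)\,e^{it\widetilde S(u,\xi)}\,d\,\mathrm{Re}\,\xi\;d\,\mathrm{Im}\,\xi:=\lim_{\rho\to\infty}\int_{|\xi|\le\rho}|\xi|^{\alpha}\,\psi_R(\xi)\,e^{it\widetilde S(u,\xi)}\,d\,\mathrm{Re}\,\xi\;d\,\mathrm{Im}\,\xi$$ converges, and there is a constant $C>0$, depending only on $\alpha$, $\varepsilon$, $R$ and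 the chosen cutoff $\psi_R$, such that $$|I_R(t,u)|\le\frac{C}{t^{1-\varepsilon}}\qquad\text{for all } t>0 \text{ and all } u\in\mathbb C.$$ -/

import Mathlib

open Filter Topology
open scoped ContDiff ComplexConjugate

noncomputable section

namespace NovikovVeselov

/-- The phase `S̃(u, ξ) = (ξ³ + ξ̄³)(1 - 3E/(ξ ξ̄)) + (ū ξ + u ξ̄)/2` of the linearized
Novikov--Veselov equation at energy `E`. It is real valued, but is written as a complex number.
(The value at the single point `ξ = 0` is irrelevant below, since the cutoff vanishes there.) -/
def phase (E : ℝ) (u ξ : ℂ) : ℂ :=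
  (ξ ^ 3 + conj ξ ^ 3) * (1 - 3 * (E : ℂ) / (ξ * conj ξ)) + (1 / 2) * (conj u * ξ + u * conj ξ)

/-- `ψ` is a smooth cutoff to the frequencies beyond `R`: it is a `C^∞` function on the real plane
`ℂ = ℝ²` with values in `[0, 1]`, equal to `0` for `|ξ| ≤ R` and to `1` for `|ξ| ≥ R + 1`. -/
structure IsHighFrequencyCutoff (R : ℝ) (ψ : ℂ → ℝ) : Prop where
  smooth : ContDiff ℝ ∞ ψ
  mem_Icc : ∀ ξ, ψ ξ ∈ Set.Icc (0 : ℝ) 1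
  eq_zero : ∀ ξ, ‖ξ‖ ≤ R → ψ ξ = 0
  eq_one : ∀ ξ, R + 1 ≤ ‖ξ‖ → ψ ξ = 1

/-- The integrand `|ξ|^α ψ(ξ) exp(i t S̃(u, ξ))`, at energy `E = 1`. -/
def integrand (α : ℝ) (ψ : ℂ → ℝ) (t : ℝ) (u ξ : ℂ) : ℂ :=
  ((‖ξ‖ ^ α * ψ ξ : ℝ) : ℂ) * Complex.exp (Complex.I * (t : ℂ) * phase 1 u ξ)

/-- `J` is the value of the (conditionally convergent) oscillatory integral of `f` over the plane:
the limit as `ρ → ∞` of the Lebesgue integrals of `f` over the disks `|ξ| ≤ ρ`. -/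
def HasOscillatoryIntegral (f : ℂ → ℂ) (J : ℂ) : Prop :=
  Tendsto (fun ρ : ℝ => ∫ ξ in Metric.closedBall (0 : ℂ) ρ, f ξ) atTop (𝓝 J)

end NovikovVeselov

end

/-! The proof is a single integration by parts, arranged so that no critical point has to be
located. Write `G` for `phaseGrad u` and `D = |ξ| + t|G|²`.

Nondegeneracy. In `G` the term `6ξ²` dominates the terms of modulus 1, so for `|ξ|, |ζ| ≥ R > 2` the
difference `G(ξ) - G(ζ)` controls `ξ² - ζ²` uniformly in `u` (`norm_phaseGrad_sub_ge`). With `ζ` a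
minimizer of `|G|` on `|ξ| ≥ R`, this gives `|G(ξ)| ≥ c|ξ|·min(|ξ-ζ|, |ξ+ζ|)`, whether or not `G`
vanishes anywhere.

Integration by parts. Split `1 = |ξ|/D + t|G|²/D`. The second part of the integrand is `-i
W·∇e^{itS}`, where `W` is `field`, and becomes `i e^{itS} div W`. Since `D` never vanishes away from
the origin, no neighbourhood of the critical points is cut out. The result is `regularIntegrand`.

Decay. The weighted inequality `D ≥ |ξ|^ε (t|G|²)^(1-ε)` bounds the new integrand by `t^(-(1-ε))`
times kernels centred at `0` and `±ζ`, of order `2-2ε` at the centre and `3-α-3ε` at infinity. They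
are integrable because `ε > 0` and `ε < (1-α)/3`, and their integrals do not depend on `ζ`, hence
not on `u`.

Convergence. Discs are smoothed in a layer of area `π/ρ`. Both the boundary term and the error
against the sharp disc are `O(ρ^(α-1))`, for fixed `t` and `u`, and vanish since `α < 1`. -/

noncomputable section

namespace NovikovVeselov

open MeasureTheory Set

/-! ### The gradient of the phase -/

/-- The conjugate of the gradient of the phase at energy `1`: the differential of
`phase 1 u` at `ξ` is `h ↦ Re (phaseGrad u ξ * h)`. -/
def phaseGrad (u ξ : ℂ) : ℂ :=
  6 * (ξ ^ 2 - 2 * (ξ / conj ξ) + (conj ξ / ξ) ^ 2) + conj u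

/-- Radial projection onto the disc of radius `m` is 1-Lipschitz. Explicitly, the difference of the
squares is `(a-b)² + 2(1-⟨v,v'⟩)(ab-m²)`. It is applied to `ξ² = |ξ|²·(ξ/ξ̄)` with `m = R²`. -/
theorem mul_norm_sub_le_norm_smul_sub_smul {v v' : ℂ} (h : ‖v‖ = 1) (h' : ‖v'‖ = 1)
    {a b m : ℝ} (hm : 0 ≤ m) (ha : m ≤ a) (hb : m ≤ b) :
    m * ‖v - v'‖ ≤ ‖(a : ℂ) * v - b * v'‖ := by
  have e1 : v.re ^ 2 + v.im ^ 2 = 1 := by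
    have := Complex.sq_norm v
    rw [h, Complex.normSq_apply] at this
    linarith
  have e2 : v'.re ^ 2 + v'.im ^ 2 = 1 := by
    have := Complex.sq_norm v'
    rw [h', Complex.normSq_apply] at this
    linarith
  refine abs_le_of_sq_le_sq' ?_ (norm_nonneg _) |>.2
  rw [mul_pow, Complex.sq_norm, Complex.sq_norm, Complex.normSq_apply, Complex.normSq_apply]
  simp only [Complex.sub_re, Complex.sub_im, Complex.mul_re, Complex.mul_im, Complex.ofReal_re,
    Complex.ofReal_im, zero_mul, sub_zero, add_zero]
  have hc : 0 ≤ 1 - (v.re * v'.re + v.im * v'.im) := by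
    nlinarith [sq_nonneg (v.re - v'.re), sq_nonneg (v.im - v'.im)]
  have hab : 0 ≤ a * b - m ^ 2 := by nlinarith
  have key := mul_nonneg hc hab
  have : (a * v.re - b * v'.re) * (a * v.re - b * v'.re) +
      (a * v.im - b * v'.im) * (a * v.im - b * v'.im) -
      m ^ 2 * ((v.re - v'.re) * (v.re - v'.re) + (v.im - v'.im) * (v.im - v'.im)) =
      (a - b) ^ 2 + 2 * ((1 - (v.re * v'.re + v.im * v'.im)) * (a * b - m ^ 2)) := by
    linear_combination (a ^ 2 - m ^ 2) * e1 + (b ^ 2 - m ^ 2) * e2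
  nlinarith [sq_nonneg (a - b)]

theorem norm_div_conj {ξ : ℂ} (hξ : ξ ≠ 0) : ‖ξ / conj ξ‖ = 1 := by
  rw [norm_div, RCLike.norm_conj, div_self (norm_ne_zero_iff.2 hξ)]

theorem norm_conj_div {ξ : ℂ} (hξ : ξ ≠ 0) : ‖conj ξ / ξ‖ = 1 := by
  rw [norm_div, RCLike.norm_conj, div_self (norm_ne_zero_iff.2 hξ)]

theorem sq_eq_norm_sq_mul_div_conj (ξ : ℂ) : ξ ^ 2 = ((‖ξ‖ ^ 2 : ℝ) : ℂ) * (ξ / conj ξ) := by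
  rcases eq_or_ne ξ 0 with rfl | hξ
  · simp
  have hc : conj ξ ≠ 0 := by simpa using hξ
  push_cast
  rw [← Complex.mul_conj']
  field_simp

/-- The gradient of the phase is, up to the reparametrization `z = ξ²`, uniformly expanding. -/
theorem norm_phaseGrad_sub_ge {R : ℝ} (hR : 0 < R) (u : ℂ) {ξ ζ : ℂ} (hξ : R ≤ ‖ξ‖)
    (hζ : R ≤ ‖ζ‖) :
    6 * (1 - 4 / R ^ 2) * ‖ξ ^ 2 - ζ ^ 2‖ ≤ ‖phaseGrad u ξ - phaseGrad u ζ‖ := by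
  have hξ0 : ξ ≠ 0 := norm_pos_iff.1 (hR.trans_le hξ)
  have hζ0 : ζ ≠ 0 := norm_pos_iff.1 (hR.trans_le hζ)
  set v := ξ / conj ξ with hv
  set v' := ζ / conj ζ with hv'
  have n1 : ‖v‖ = 1 := norm_div_conj hξ0
  have n2 : ‖v'‖ = 1 := norm_div_conj hζ0
  have c1 : conj ξ / ξ = conj v := by simp [hv]
  have c2 : conj ζ / ζ = conj v' := by simp [hv']
  have hrad : R ^ 2 * ‖v - v'‖ ≤ ‖ξ ^ 2 - ζ ^ 2‖ := by
    rw [sq_eq_norm_sq_mul_div_conj ξ, sq_eq_norm_sq_mul_div_conj ζ]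
    exact mul_norm_sub_le_norm_smul_sub_smul n1 n2 (by positivity) (by gcongr) (by gcongr)
  -- The part of the gradient of degree zero depends only on the unit vector `v` and is 4-Lipschitz
  -- in it: 2 from the linear term, 2 from the square.
  have hK : ‖-2 * (v - v') + (conj v ^ 2 - conj v' ^ 2)‖ ≤ 4 * ‖v - v'‖ := by
    have h1 : conj v ^ 2 - conj v' ^ 2 = (conj v + conj v') * conj (v - v') := by
      rw [map_sub]; ring
    rw [h1]
    refine (norm_add_le _ _).trans ?_
    rw [norm_mul, norm_mul, RCLike.norm_conj]
    have h2 : ‖conj v + conj v'‖ ≤ 2 := by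
      refine (norm_add_le _ _).trans ?_
      rw [RCLike.norm_conj, RCLike.norm_conj, n1, n2]; norm_num
    have h3 : ‖(-2 : ℂ)‖ = 2 := by simp
    rw [h3]
    nlinarith [norm_nonneg (v - v')]
  have hE : phaseGrad u ξ - phaseGrad u ζ =
      6 * ((ξ ^ 2 - ζ ^ 2) - -(-2 * (v - v') + (conj v ^ 2 - conj v' ^ 2))) := by
    simp only [phaseGrad, c1, c2, ← hv, ← hv']
    ring
  rw [hE, norm_mul]
  have h4 := norm_sub_norm_le (ξ ^ 2 - ζ ^ 2) (-(-2 * (v - v') + (conj v ^ 2 - conj v' ^ 2)))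
  rw [norm_neg] at h4
  have h5 : ‖(6 : ℂ)‖ = 6 := by simp
  rw [h5]
  have h6 : 4 * ‖v - v'‖ ≤ 4 / R ^ 2 * ‖ξ ^ 2 - ζ ^ 2‖ := by
    rw [div_mul_eq_mul_div, le_div_iff₀ (by positivity)]
    nlinarith
  nlinarith

theorem norm_phaseGrad_ge (u : ℂ) {ξ : ℂ} (hξ : ξ ≠ 0) :
    6 * (‖ξ‖ ^ 2 - 3) - ‖u‖ ≤ ‖phaseGrad u ξ‖ := by
  have h : 6 * ξ ^ 2 = phaseGrad u ξ + (12 * (ξ / conj ξ) - 6 * (conj ξ / ξ) ^ 2 - conj u) := by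
    simp only [phaseGrad]; ring
  have h2 : ‖(6 : ℂ) * ξ ^ 2‖ = 6 * ‖ξ‖ ^ 2 := by simp
  have h3 : ‖12 * (ξ / conj ξ) - 6 * (conj ξ / ξ) ^ 2 - conj u‖ ≤ 18 + ‖u‖ := by
    refine (norm_sub_le _ _).trans ?_
    refine add_le_add ((norm_sub_le _ _).trans ?_) (RCLike.norm_conj u).le
    rw [norm_mul, norm_mul, norm_pow, norm_div_conj hξ, norm_conj_div hξ]
    norm_num
  have h4 := norm_add_le (phaseGrad u ξ) (12 * (ξ / conj ξ) - 6 * (conj ξ / ξ) ^ 2 - conj u)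
  rw [← h, h2] at h4
  linarith

theorem contDiffAt_phaseGrad (u : ℂ) {ξ : ℂ} (hξ : ξ ≠ 0) :
    ContDiffAt ℝ ∞ (phaseGrad u) ξ := by
  have hc : ContDiffAt ℝ ∞ (fun z : ℂ => conj z) ξ := Complex.conjCLE.contDiff.contDiffAt
  have hi : ContDiffAt ℝ ∞ (fun z : ℂ => z) ξ := contDiffAt_id
  have hc0 : conj ξ ≠ 0 := by simpa using hξ
  unfold phaseGrad
  simp only [div_eq_mul_inv]
  exact (contDiffAt_const.mul (((hi.pow 2).sub (contDiffAt_const.mul (hi.mul (hc.inv hc0)))).add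
    ((hc.mul (hi.inv hξ)).pow 2))).add contDiffAt_const

/-- For `ζ` minimizing `|G|` on the closed exterior region, `|G(ξ) - G(ζ)| ≤ 2|G(ξ)|`, which halves
the expansion constant. The minimum is attained because `|G|` grows quadratically. -/
theorem exists_norm_phaseGrad_ge {R : ℝ} (hR : 0 < R) (u : ℂ) :
    ∃ ζ : ℂ, R ≤ ‖ζ‖ ∧ ∀ ξ : ℂ, R ≤ ‖ξ‖ →
      3 * (1 - 4 / R ^ 2) * ‖ξ ^ 2 - ζ ^ 2‖ ≤ ‖phaseGrad u ξ‖ := by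
  have hcl : IsClosed {ξ : ℂ | R ≤ ‖ξ‖} := isClosed_le continuous_const continuous_norm
  have hcont : ContinuousOn (fun ξ => ‖phaseGrad u ξ‖) {ξ : ℂ | R ≤ ‖ξ‖} := fun ξ hξ =>
    ((contDiffAt_phaseGrad u (norm_pos_iff.1 (hR.trans_le hξ))).continuousAt.norm).continuousWithinAt
  have hx0 : (R : ℂ) ∈ {ξ : ℂ | R ≤ ‖ξ‖} := by simp [abs_of_pos hR]
  obtain ⟨ζ, hζ, hmin⟩ := hcont.exists_isMinOn' hcl hx0 (by
    have ht : Tendsto (fun ξ : ℂ => ‖ξ‖) (cocompact ℂ) atTop := tendsto_norm_cocompact_atTop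
    have h1 := ht.eventually_ge_atTop (‖u‖ + ‖phaseGrad u R‖ + 4)
    refine (h1.filter_mono inf_le_left).mono fun ξ hξ => ?_
    have hu := norm_nonneg u
    have hp := norm_nonneg (phaseGrad u R)
    have h0 : ξ ≠ 0 := norm_pos_iff.1 (by linarith)
    have := norm_phaseGrad_ge u h0
    nlinarith)
  refine ⟨ζ, hζ, fun ξ hξ => ?_⟩
  have h1 := norm_phaseGrad_sub_ge hR u hξ hζ
  have h2 : ‖phaseGrad u ζ‖ ≤ ‖phaseGrad u ξ‖ := hmin hξ
  have h3 := norm_sub_le (phaseGrad u ξ) (phaseGrad u ζ)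
  linarith

/-- Lower bound of the gradient in terms of the distance to the (approximate) critical points
`± ζ`. -/
theorem norm_mul_min_le_norm_sq_sub_sq (ξ ζ : ℂ) :
    ‖ξ‖ * min ‖ξ - ζ‖ ‖ξ + ζ‖ ≤ ‖ξ ^ 2 - ζ ^ 2‖ := by
  have h : ξ ^ 2 - ζ ^ 2 = (ξ - ζ) * (ξ + ζ) := by ring
  rw [h, norm_mul]
  -- Hence the larger of the two factors is at least `‖ξ‖`.
  have h2 : 2 * ‖ξ‖ ≤ ‖ξ - ζ‖ + ‖ξ + ζ‖ := by
    have := norm_add_le (ξ - ζ) (ξ + ζ)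
    have e : ξ - ζ + (ξ + ζ) = 2 * ξ := by ring
    rw [e, norm_mul] at this
    simpa using this
  have a1 := norm_nonneg (ξ - ζ)
  have a2 := norm_nonneg (ξ + ζ)
  rcases le_total ‖ξ - ζ‖ ‖ξ + ζ‖ with h3 | h3
  · rw [min_eq_left h3]; nlinarith
  · rw [min_eq_right h3]; nlinarith

/-! ### An integrable kernel -/

/-- The kernel `|ξ|^{-b}` for `|ξ| < 1`, `|ξ|^{-p}` for `|ξ| ≥ 1`. -/
def kernel (b p : ℝ) (ξ : ℂ) : ℝ := if ‖ξ‖ < 1 then ‖ξ‖ ^ (-b) else ‖ξ‖ ^ (-p)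

theorem kernel_nonneg (b p : ℝ) (ξ : ℂ) : 0 ≤ kernel b p ξ := by
  unfold kernel; split_ifs <;> positivity

theorem kernel_of_one_le (b p : ℝ) {ξ : ℂ} (h : 1 ≤ ‖ξ‖) : kernel b p ξ = ‖ξ‖ ^ (-p) :=
  if_neg h.not_gt

/-- In polar coordinates the weight is `r`, so the critical exponent is 2 at both ends. -/
theorem integrable_kernel {b p : ℝ} (hb : b < 2) (hp : 2 < p) : Integrable (kernel b p) := by
  have h : kernel b p = fun ξ : ℂ => (fun r : ℝ => if r < 1 then r ^ (-b) else r ^ (-p)) ‖ξ‖ := rfl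
  rw [h, integrable_fun_norm_addHaar volume
    (f := fun r : ℝ => if r < 1 then r ^ (-b) else r ^ (-p)), Complex.finrank_real_complex]
  rw [← Ioc_union_Ioi_eq_Ioi (zero_le_one (α := ℝ)), integrableOn_union]
  constructor
  · rw [integrableOn_Ioc_iff_integrableOn_Ioo]
    have h1 : IntegrableOn (fun r : ℝ => r ^ (1 - b)) (Ioo 0 1) :=
      (intervalIntegral.integrableOn_Ioo_rpow_iff one_pos).2 (by linarith)
    refine h1.congr_fun (fun r hr => ?_) measurableSet_Ioo
    simp only [hr.2, if_true, smul_eq_mul]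
    rw [sub_eq_add_neg, Real.rpow_add hr.1]; simp
  · have h1 : IntegrableOn (fun r : ℝ => r ^ (1 - p)) (Ioi 1) :=
      integrableOn_Ioi_rpow_of_lt (by linarith) one_pos
    refine h1.congr_fun (fun r hr => ?_) measurableSet_Ioi
    have hr' : (1 : ℝ) < r := hr
    simp only [not_lt.2 hr'.le, if_false, smul_eq_mul]
    rw [sub_eq_add_neg, Real.rpow_add (by linarith)]; simp

/-- A product of two powers is dominated by kernels centred at the two singularities. -/
theorem rpow_mul_rpow_le_kernel {a b : ℝ} (ha : 0 ≤ a) (hb : 0 ≤ b) {ξ ζ : ℂ}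
    (hξ : 1 ≤ ‖ξ‖) (hζ : ζ ≠ 0) :
    ‖ξ‖ ^ (-a) * ‖ζ‖ ^ (-b) ≤ kernel b (a + b) ξ + kernel b (a + b) ζ := by
  have hξ0 : 0 < ‖ξ‖ := by linarith
  have hζ0 : 0 < ‖ζ‖ := norm_pos_iff.2 hζ
  -- The power of the larger modulus is replaced by that of the smaller one. If `‖ζ‖ < 1`, the
  -- factor in `ξ` is at most 1 and is dropped.
  rcases le_total ‖ξ‖ ‖ζ‖ with h | h
  · refine le_add_of_le_of_nonneg ?_ (kernel_nonneg _ _ _)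
    rw [kernel_of_one_le _ _ hξ, neg_add, Real.rpow_add hξ0]
    gcongr 1
    exact Real.rpow_le_rpow_of_nonpos hξ0 h (by linarith)
  · refine le_add_of_nonneg_of_le (kernel_nonneg _ _ _) ?_
    unfold kernel
    split_ifs with h1
    · have : ‖ξ‖ ^ (-a) ≤ 1 := Real.rpow_le_one_of_one_le_of_nonpos hξ (by linarith)
      have h2 : 0 ≤ ‖ζ‖ ^ (-b) := by positivity
      nlinarith
    · rw [neg_add, Real.rpow_add hζ0]
      gcongr 1
      exact Real.rpow_le_rpow_of_nonpos hζ0 h (by linarith)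

/-! ### Derivatives -/

theorem fderiv_apply_of_hasDerivAt {F : Type*} [NormedAddCommGroup F] [NormedSpace ℝ F]
    {f : ℂ → F} {ξ h : ℂ} {y : F} (hf : DifferentiableAt ℝ f ξ)
    (hy : HasDerivAt (fun s : ℝ => f (ξ + s • h)) y 0) : fderiv ℝ f ξ h = y :=
  (hf.hasFDerivAt.hasLineDerivAt h).unique hy

theorem hasDerivAt_line (ξ h : ℂ) : HasDerivAt (fun s : ℝ => ξ + s • h) h 0 := by
  simpa using ((hasDerivAt_id (0 : ℝ)).smul_const h).const_add ξ

theorem hasDerivAt_conj_line (ξ h : ℂ) :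
    HasDerivAt (fun s : ℝ => conj (ξ + s • h)) (conj h) 0 := by
  simpa using ((hasDerivAt_id (0 : ℝ)).smul_const (conj h)).const_add (conj ξ)

theorem contDiffAt_phase (u : ℂ) {ξ : ℂ} (hξ : ξ ≠ 0) : ContDiffAt ℝ ∞ (phase 1 u) ξ := by
  have hc : ContDiffAt ℝ ∞ (fun z : ℂ => conj z) ξ := Complex.conjCLE.contDiff.contDiffAt
  have hi : ContDiffAt ℝ ∞ (fun z : ℂ => z) ξ := contDiffAt_id
  have hc0 : ξ * conj ξ ≠ 0 := by simpa using hξ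
  unfold phase
  simp only [div_eq_mul_inv]
  exact (((hi.pow 3).add (hc.pow 3)).mul (contDiffAt_const.sub
    (contDiffAt_const.mul ((hi.mul hc).inv hc0)))).add
    (contDiffAt_const.mul ((contDiffAt_const.mul hi).add (contDiffAt_const.mul hc)))

theorem fderiv_phase_apply (u : ℂ) {ξ : ℂ} (hξ : ξ ≠ 0) (h : ℂ) :
    fderiv ℝ (phase 1 u) ξ h = ((phaseGrad u ξ * h).re : ℂ) := by
  have hc0 : conj ξ ≠ 0 := by simpa using hξ
  refine fderiv_apply_of_hasDerivAt ((contDiffAt_phase u hξ).differentiableAt (by simp)) ?_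
  have hl := hasDerivAt_line ξ h
  have hc := hasDerivAt_conj_line ξ h
  have h0 : (ξ + (0 : ℝ) • h) * conj (ξ + (0 : ℝ) • h) ≠ 0 := by simpa using hξ
  have key := (((hl.fun_pow 3).fun_add (hc.fun_pow 3)).fun_mul (((hasDerivAt_const (0 : ℝ)
    (3 * ((1 : ℝ) : ℂ))).fun_div (hl.fun_mul hc) h0).const_sub 1)).fun_add
    (((hl.const_mul (conj u)).fun_add (hc.const_mul u)).const_mul (1 / 2))
  refine key.congr_deriv ?_
  rw [Complex.re_eq_add_conj]
  simp only [phaseGrad, zero_smul, add_zero, map_mul, map_add, map_sub, map_div₀, map_pow,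
    Complex.conj_conj, map_ofNat]
  push_cast
  field_simp
  ring

/-- The quadratic term contributes `12‖ξ‖`. The two quotients contribute `48/‖ξ‖`, which is at most
`12‖ξ‖` once `‖ξ‖ ≥ 2`. -/
theorem norm_fderiv_phaseGrad_le (u : ℂ) {ξ : ℂ} (hξ : 2 ≤ ‖ξ‖) :
    ‖fderiv ℝ (phaseGrad u) ξ‖ ≤ 24 * ‖ξ‖ := by
  have hr : 0 < ‖ξ‖ := by linarith
  have hξ0 : ξ ≠ 0 := norm_pos_iff.1 hr
  have hc0 : conj ξ ≠ 0 := by simpa using hξ0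
  refine ContinuousLinearMap.opNorm_le_bound _ (by positivity) fun h => ?_
  have hl := hasDerivAt_line ξ h
  have hc := hasDerivAt_conj_line ξ h
  have h0 : ξ + (0 : ℝ) • h ≠ 0 := by simpa using hξ0
  have h0' : conj (ξ + (0 : ℝ) • h) ≠ 0 := by simpa using hξ0
  have key := ((((hl.fun_pow 2).fun_sub ((hl.fun_div hc h0').const_mul 2)).fun_add
    ((hc.fun_div hl h0).fun_pow 2)).const_mul 6).add_const (conj u)
  rw [fderiv_apply_of_hasDerivAt ((contDiffAt_phaseGrad u hξ0).differentiableAt (by simp)) key]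
  simp only [zero_smul, add_zero]
  have hn : ‖conj ξ‖ = ‖ξ‖ := RCLike.norm_conj ξ
  have hn' : ‖conj h‖ = ‖h‖ := RCLike.norm_conj h
  have e1 : ‖(h * conj ξ - ξ * conj h) / conj ξ ^ 2‖ ≤ 2 * ‖h‖ / ‖ξ‖ := by
    rw [norm_div, norm_pow, hn, div_le_div_iff₀ (by positivity) hr]
    have := norm_sub_le (h * conj ξ) (ξ * conj h)
    rw [norm_mul, norm_mul, hn, hn'] at this
    nlinarith
  have e2 : ‖(conj h * ξ - conj ξ * h) / ξ ^ 2‖ ≤ 2 * ‖h‖ / ‖ξ‖ := by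
    rw [norm_div, norm_pow, div_le_div_iff₀ (by positivity) hr]
    have := norm_sub_le (conj h * ξ) (conj ξ * h)
    rw [norm_mul, norm_mul, hn, hn'] at this
    nlinarith
  have e3 : 2 * ‖h‖ / ‖ξ‖ ≤ ‖ξ‖ * ‖h‖ / 2 := by
    rw [div_le_div_iff₀ hr two_pos]
    nlinarith [norm_nonneg h, mul_nonneg (norm_nonneg h) (by nlinarith : 0 ≤ ‖ξ‖ * ‖ξ‖ - 4)]
  have e4 : ‖conj ξ / ξ‖ = 1 := norm_conj_div hξ0
  rw [norm_mul]
  have t1 := norm_add_le ((((2 : ℕ) : ℂ) * ξ ^ (2 - 1) * h -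
    2 * ((h * conj ξ - ξ * conj h) / conj ξ ^ 2)))
    (((2 : ℕ) : ℂ) * (conj ξ / ξ) ^ (2 - 1) * ((conj h * ξ - conj ξ * h) / ξ ^ 2))
  have t2 := norm_sub_le (((2 : ℕ) : ℂ) * ξ ^ (2 - 1) * h)
    (2 * ((h * conj ξ - ξ * conj h) / conj ξ ^ 2))
  have t3 : ‖((2 : ℕ) : ℂ) * ξ ^ (2 - 1) * h‖ = 2 * ‖ξ‖ * ‖h‖ := by simp
  have t4 : ‖2 * ((h * conj ξ - ξ * conj h) / conj ξ ^ 2)‖ =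
    2 * ‖(h * conj ξ - ξ * conj h) / conj ξ ^ 2‖ := by rw [norm_mul]; simp
  have t5 : ‖((2 : ℕ) : ℂ) * (conj ξ / ξ) ^ (2 - 1) * ((conj h * ξ - conj ξ * h) / ξ ^ 2)‖ =
    2 * ‖(conj h * ξ - conj ξ * h) / ξ ^ 2‖ := by
    rw [norm_mul, norm_mul, norm_pow, e4]; simp
  have t6 : ‖(6 : ℂ)‖ = 6 := by simp
  rw [t3, t4] at t2
  rw [t5] at t1
  rw [t6]
  refine (mul_le_mul_of_nonneg_left (t1.trans (add_le_add t2 le_rfl)) (by norm_num)).trans ?_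
  linarith

/-- The amplitude `|ξ|^α ψ(ξ)`. -/
def amplitude (α : ℝ) (ψ : ℂ → ℝ) (ξ : ℂ) : ℝ := ‖ξ‖ ^ α * ψ ξ

theorem IsHighFrequencyCutoff.exists_norm_fderiv_amplitude_le {R : ℝ} (hR : 0 < R) {ψ : ℂ → ℝ}
    (hψ : IsHighFrequencyCutoff R ψ) {α : ℝ} (hα₀ : 0 ≤ α) (hα₁ : α < 1) :
    ∃ C : ℝ, 0 ≤ C ∧ ∀ ξ : ℂ, R ≤ ‖ξ‖ →
      ‖fderiv ℝ (amplitude α ψ) ξ‖ ≤ C * ‖ξ‖ ^ (α - 1) := by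
  have hdψ : Continuous (fderiv ℝ ψ) := hψ.smooth.continuous_fderiv (by simp)
  obtain ⟨M, hM⟩ := (isCompact_closedBall (0 : ℂ) (R + 1)).exists_bound_of_continuousOn
    hdψ.continuousOn
  have hM0 : 0 ≤ M := (norm_nonneg _).trans (hM 0 (by simp; linarith))
  refine ⟨1 + M * (R + 1), by positivity, fun ξ hξ => ?_⟩
  have hr : 0 < ‖ξ‖ := hR.trans_le hξ
  have hξ0 : ξ ≠ 0 := norm_pos_iff.1 hr
  have hn : HasFDerivAt (fun z : ℂ => ‖z‖) (fderiv ℝ (fun z : ℂ => ‖z‖) ξ) ξ :=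
    ((contDiffAt_norm ℝ hξ0 (n := 1)).differentiableAt (by simp)).hasFDerivAt
  have hn1 : ‖fderiv ℝ (fun z : ℂ => ‖z‖) ξ‖ ≤ 1 := by
    simpa using norm_fderiv_le_of_lipschitz ℝ (lipschitzWith_one_norm (E := ℂ)) (x₀ := ξ)
  have hψ' : HasFDerivAt ψ (fderiv ℝ ψ ξ) ξ :=
    (hψ.smooth.contDiffAt.differentiableAt (by simp)).hasFDerivAt
  have hA := (hn.rpow_const (p := α) (Or.inl hr.ne')).fun_mul hψ'
  unfold amplitude
  rw [hA.fderiv]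
  have hψ1 := hψ.mem_Icc ξ
  -- The derivative of the cutoff lives in the disc of radius `R + 1`, so it may be charged with any
  -- power of `‖ξ‖`.
  have hdψ1 : ‖fderiv ℝ ψ ξ‖ * ‖ξ‖ ≤ M * (R + 1) := by
    rcases le_or_gt ‖ξ‖ (R + 1) with h | h
    · have := hM ξ (by simpa using h)
      gcongr
    · have : ψ =ᶠ[𝓝 ξ] fun _ => 1 := by
        filter_upwards [(isOpen_lt continuous_const continuous_norm).mem_nhds h] with z hz
        exact hψ.eq_one z (le_of_lt hz)
      rw [this.fderiv_eq]
      simp only [fderiv_fun_const, Pi.zero_apply, norm_zero, zero_mul]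
      positivity
  have hpow : ‖ξ‖ ^ α = ‖ξ‖ ^ (α - 1) * ‖ξ‖ := by
    rw [Real.rpow_sub_one hr.ne']; field_simp
  have hp0 : 0 ≤ ‖ξ‖ ^ (α - 1) := by positivity
  refine (norm_add_le _ _).trans ?_
  simp only [norm_smul, Real.norm_eq_abs, abs_mul, abs_of_nonneg hα₀, abs_of_nonneg hψ1.1,
    abs_of_nonneg hp0]
  rw [abs_of_nonneg (by positivity : 0 ≤ ‖ξ‖ ^ α), hpow]
  have h1 : ψ ξ * (α * ‖ξ‖ ^ (α - 1) * ‖fderiv ℝ (fun z : ℂ => ‖z‖) ξ‖) ≤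
      1 * (1 * ‖ξ‖ ^ (α - 1) * 1) := by
    have := hψ1.2
    gcongr
  nlinarith [mul_le_mul_of_nonneg_left hdψ1 hp0]

/-- The regularised squared gradient `|ξ| + t |∇S|²`. -/
def denom (t : ℝ) (u ξ : ℂ) : ℝ := ‖ξ‖ + t * ‖phaseGrad u ξ‖ ^ 2

theorem norm_le_denom {t : ℝ} (ht : 0 < t) (u ξ : ℂ) : ‖ξ‖ ≤ denom t u ξ :=
  le_add_of_nonneg_right (by positivity)

theorem mul_sq_le_denom (t : ℝ) (u ξ : ℂ) : t * ‖phaseGrad u ξ‖ ^ 2 ≤ denom t u ξ :=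
  le_add_of_nonneg_left (norm_nonneg _)

/-- The vector field `(|ξ|^α ψ / (|ξ| + t |∇S|²)) ∇S` used for the integration by parts. -/
def field (α : ℝ) (ψ : ℂ → ℝ) (t : ℝ) (u ξ : ℂ) : ℂ :=
  (amplitude α ψ ξ * (denom t u ξ)⁻¹) • conj (phaseGrad u ξ)

/-- The product rule gives one term for each of `A`, `1/D` and the conjugate of `G`. Any `t`
produced by differentiating `1/D` comes with `|G|²` and is absorbed by `t|G|² ≤ D`, so no growth in
`t` survives. The 72 is 24 from the derivative of `G` plus 48 from that of `t|G|²`. -/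
theorem norm_fderiv_field_le {α : ℝ} {ψ : ℂ → ℝ} {C t : ℝ} (ht : 0 < t) (u : ℂ) {ξ : ℂ}
    (hξ : 2 ≤ ‖ξ‖) (hψ : ψ ξ ∈ Set.Icc (0 : ℝ) 1) (hψd : DifferentiableAt ℝ ψ ξ)
    (hA' : ‖fderiv ℝ (amplitude α ψ) ξ‖ ≤ C * ‖ξ‖ ^ (α - 1)) :
    ‖fderiv ℝ (field α ψ t u) ξ‖ ≤
      (C + 1) * (‖ξ‖ ^ (α - 1) * ‖phaseGrad u ξ‖ / denom t u ξ) +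
        72 * (‖ξ‖ ^ (α + 1) / denom t u ξ) := by
  have hr : 0 < ‖ξ‖ := by linarith
  have hξ0 : ξ ≠ 0 := norm_pos_iff.1 hr
  have hD : 0 < denom t u ξ := hr.trans_le (norm_le_denom ht u ξ)
  have hn : HasFDerivAt (fun z : ℂ => ‖z‖) (fderiv ℝ (fun z : ℂ => ‖z‖) ξ) ξ :=
    ((contDiffAt_norm ℝ hξ0 (n := 1)).differentiableAt (by simp)).hasFDerivAt
  have hn1 : ‖fderiv ℝ (fun z : ℂ => ‖z‖) ξ‖ ≤ 1 := by
    simpa using norm_fderiv_le_of_lipschitz ℝ (lipschitzWith_one_norm (E := ℂ)) (x₀ := ξ)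
  have hE : HasFDerivAt (phaseGrad u) (fderiv ℝ (phaseGrad u) ξ) ξ :=
    ((contDiffAt_phaseGrad u hξ0).differentiableAt (by simp)).hasFDerivAt
  have hE1 := norm_fderiv_phaseGrad_le u hξ
  have hAd : HasFDerivAt (amplitude α ψ) (fderiv ℝ (amplitude α ψ) ξ) ξ :=
    ((hn.rpow_const (p := α) (Or.inl hr.ne')).fun_mul
      hψd.hasFDerivAt).differentiableAt.hasFDerivAt
  obtain ⟨D', hD', hD'n⟩ : ∃ D' : ℂ →L[ℝ] ℝ, HasFDerivAt (denom t u) D' ξ ∧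
      ‖D'‖ ≤ 1 + t * (2 * (‖phaseGrad u ξ‖ * (24 * ‖ξ‖))) := by
    refine ⟨_, hn.fun_add (hE.norm_sq.const_mul t), ?_⟩
    refine (norm_add_le _ _).trans (add_le_add hn1 ?_)
    rw [norm_smul, Real.norm_eq_abs, abs_of_pos ht]
    gcongr
    rw [two_smul, two_mul]
    refine (norm_add_le _ _).trans ?_
    have : ‖((innerSL ℝ) (phaseGrad u ξ)).comp (fderiv ℝ (phaseGrad u) ξ)‖ ≤
        ‖phaseGrad u ξ‖ * (24 * ‖ξ‖) := by
      refine (ContinuousLinearMap.opNorm_comp_le _ _).trans ?_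
      rw [innerSL_apply_norm]
      gcongr
    gcongr
  have hinv : HasFDerivAt (fun z => (denom t u z)⁻¹) ((-(denom t u ξ ^ 2)⁻¹) • D') ξ :=
    (hasDerivAt_inv hD.ne').comp_hasFDerivAt ξ hD'
  have hcE : HasFDerivAt (fun z => conj (phaseGrad u z))
      ((Complex.conjCLE : ℂ →L[ℝ] ℂ).comp (fderiv ℝ (phaseGrad u) ξ)) ξ :=
    (Complex.conjCLE : ℂ →L[ℝ] ℂ).hasFDerivAt.comp ξ hE
  have hW := (hAd.fun_mul hinv).fun_smul hcE
  have hWf : fderiv ℝ (field α ψ t u) ξ = _ := hW.fderiv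
  rw [hWf]
  have hA0 : 0 ≤ amplitude α ψ ξ := mul_nonneg (by positivity) hψ.1
  have hA1 : amplitude α ψ ξ ≤ ‖ξ‖ ^ α :=
    mul_le_of_le_one_right (by positivity) hψ.2
  have hconj : ‖((Complex.conjCLE : ℂ →L[ℝ] ℂ).comp (fderiv ℝ (phaseGrad u) ξ))‖ ≤ 24 * ‖ξ‖ := by
    refine ContinuousLinearMap.opNorm_le_bound _ (by positivity) fun h => ?_
    have := (fderiv ℝ (phaseGrad u) ξ).le_of_opNorm_le hE1 h
    simpa using this
  set e := ‖phaseGrad u ξ‖ with he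
  set r := ‖ξ‖ with hrdef
  set D := denom t u ξ with hDdef
  have he0 : 0 ≤ e := norm_nonneg _
  have hrD : r ≤ D := norm_le_denom ht u ξ
  have heD : t * e ^ 2 ≤ D := mul_sq_le_denom t u ξ
  have hra : r ^ α = r ^ (α - 1) * r := by
    rw [Real.rpow_sub_one hr.ne']; field_simp
  have hra1 : r ^ (α + 1) = r ^ (α - 1) * r * r := by
    rw [Real.rpow_add_one hr.ne', hra]
  have hp : 0 ≤ r ^ (α - 1) := by positivity
  have hq : ‖amplitude α ψ ξ • ((-(D ^ 2)⁻¹) • D') +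
      (D)⁻¹ • fderiv ℝ (amplitude α ψ) ξ‖ ≤
      r ^ α * ((D ^ 2)⁻¹ * (1 + t * (2 * (e * (24 * r))))) + D⁻¹ * (C * r ^ (α - 1)) := by
    refine (norm_add_le _ _).trans ?_
    simp only [norm_smul, Real.norm_eq_abs, abs_neg, abs_inv, abs_of_nonneg hA0, abs_pow,
      abs_of_pos hD]
    gcongr
  refine (norm_add_le _ _).trans ?_
  rw [norm_smul, ContinuousLinearMap.norm_smulRight_apply]
  have hce : ‖conj (phaseGrad u ξ)‖ = e := RCLike.norm_conj _
  rw [hce, norm_mul, norm_inv, Real.norm_eq_abs, Real.norm_eq_abs, abs_of_nonneg hA0,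
    abs_of_pos hD]
  refine (add_le_add (mul_le_mul_of_nonneg_left hconj (by positivity))
    (mul_le_mul_of_nonneg_right hq he0)).trans ?_
  have b1 : amplitude α ψ ξ * D⁻¹ * (24 * r) ≤ 24 * (r ^ (α + 1) / D) := by
    calc _ ≤ r ^ α * D⁻¹ * (24 * r) := by gcongr
      _ = _ := by rw [hra, hra1]; field_simp
  have b2 : r ^ α * ((D ^ 2)⁻¹ * 1) * e ≤ r ^ (α - 1) * e / D := by
    have : r * (D ^ 2)⁻¹ ≤ D⁻¹ := by
      rw [← div_eq_mul_inv, div_le_iff₀ (by positivity)]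
      field_simp; exact hrD
    calc _ = r ^ (α - 1) * e * (r * (D ^ 2)⁻¹) := by rw [hra]; ring
      _ ≤ r ^ (α - 1) * e * D⁻¹ := by gcongr
      _ = _ := by rw [div_eq_mul_inv]
  have b3 : r ^ α * ((D ^ 2)⁻¹ * (t * (2 * (e * (24 * r))))) * e ≤ 48 * (r ^ (α + 1) / D) := by
    have : t * e ^ 2 * (D ^ 2)⁻¹ ≤ D⁻¹ := by
      rw [← div_eq_mul_inv, div_le_iff₀ (by positivity)]
      field_simp; exact heD
    calc _ = 48 * r ^ (α + 1) * (t * e ^ 2 * (D ^ 2)⁻¹) := by rw [hra, hra1]; ring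
      _ ≤ 48 * r ^ (α + 1) * D⁻¹ := by gcongr
      _ = _ := by rw [div_eq_mul_inv]; ring
  have b4 : D⁻¹ * (C * r ^ (α - 1)) * e = C * (r ^ (α - 1) * e / D) := by
    rw [div_eq_mul_inv]; ring
  nlinarith

/-! ### Pointwise bounds -/

/-- Both summands are at most the denominator, so their weighted geometric mean is too. The weight
`s` on `|ξ|` costs the factor `t^s` in the decay and softens the singularity from order 2 to `2 -
2s`. -/
theorem rpow_mul_rpow_le_denom {t s : ℝ} (ht : 0 < t) (hs0 : 0 ≤ s) (hs1 : s ≤ 1) (u ξ : ℂ) :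
    ‖ξ‖ ^ s * (t ^ (1 - s) * ‖phaseGrad u ξ‖ ^ (2 - 2 * s)) ≤ denom t u ξ := by
  have hD0 : 0 ≤ denom t u ξ := (norm_nonneg ξ).trans (norm_le_denom ht u ξ)
  have h1 : ‖ξ‖ ^ s ≤ denom t u ξ ^ s :=
    Real.rpow_le_rpow (norm_nonneg _) (norm_le_denom ht u ξ) hs0
  have h2 : (t * ‖phaseGrad u ξ‖ ^ 2) ^ (1 - s) ≤ denom t u ξ ^ (1 - s) :=
    Real.rpow_le_rpow (by positivity) (mul_sq_le_denom t u ξ) (by linarith)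
  have h3 : (t * ‖phaseGrad u ξ‖ ^ 2) ^ (1 - s) =
      t ^ (1 - s) * ‖phaseGrad u ξ‖ ^ (2 - 2 * s) := by
    rw [Real.mul_rpow ht.le (by positivity), ← Real.rpow_natCast, ← Real.rpow_mul (norm_nonneg _)]
    congr 2; push_cast; ring
  rw [← h3]
  calc _ ≤ denom t u ξ ^ s * denom t u ξ ^ (1 - s) := by gcongr
    _ = denom t u ξ := by
      rw [← Real.rpow_add' hD0 (by simp)]; simp

theorem rpow_div_denom_le_kernel {α s t c : ℝ} (ht : 0 < t) (hs0 : 0 < s) (hα₀ : 0 ≤ α)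
    (hs1 : s < (1 - α) / 3) (hc : 0 < c) (u : ℂ) {ξ ζ : ℂ} (hξ : 1 ≤ ‖ξ‖) (h₁ : ξ ≠ ζ)
    (h₂ : ξ ≠ -ζ) (hζ : c * ‖ξ ^ 2 - ζ ^ 2‖ ≤ ‖phaseGrad u ξ‖) :
    ‖ξ‖ ^ (α + 1) / denom t u ξ ≤ c ^ (-(2 - 2 * s)) * (1 / t ^ (1 - s)) *
      (kernel (2 - 2 * s) (3 - α - 3 * s) ξ + kernel (2 - 2 * s) (3 - α - 3 * s) (ξ - ζ) +
        kernel (2 - 2 * s) (3 - α - 3 * s) (ξ + ζ)) := by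
  have hr : 0 < ‖ξ‖ := by linarith
  have hz1 : ξ - ζ ≠ 0 := sub_ne_zero.2 h₁
  have hz2 : ξ + ζ ≠ 0 := fun h => h₂ (eq_neg_of_add_eq_zero_left h)
  -- `z` is the displacement from the nearer of `ζ` and `-ζ`.
  obtain ⟨z, hz, hz0, hzk⟩ : ∃ z : ℂ, ‖ξ‖ * ‖z‖ ≤ ‖ξ ^ 2 - ζ ^ 2‖ ∧ z ≠ 0 ∧
      kernel (2 - 2 * s) (3 - α - 3 * s) z ≤ kernel (2 - 2 * s) (3 - α - 3 * s) (ξ - ζ) +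
        kernel (2 - 2 * s) (3 - α - 3 * s) (ξ + ζ) := by
    have h := norm_mul_min_le_norm_sq_sub_sq ξ ζ
    rcases min_choice ‖ξ - ζ‖ ‖ξ + ζ‖ with hm | hm <;> rw [hm] at h
    · exact ⟨_, h, hz1, le_add_of_nonneg_right (kernel_nonneg _ _ _)⟩
    · exact ⟨_, h, hz2, le_add_of_nonneg_left (kernel_nonneg _ _ _)⟩
  have hz0' : 0 < ‖z‖ := norm_pos_iff.2 hz0
  have hE : c * (‖ξ‖ * ‖z‖) ≤ ‖phaseGrad u ξ‖ :=
    (mul_le_mul_of_nonneg_left hz hc.le).trans hζ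
  have hE' : (c * (‖ξ‖ * ‖z‖)) ^ (2 - 2 * s) ≤ ‖phaseGrad u ξ‖ ^ (2 - 2 * s) :=
    Real.rpow_le_rpow (by positivity) hE (by linarith)
  have hD : ‖ξ‖ ^ s * (t ^ (1 - s) * (c * (‖ξ‖ * ‖z‖)) ^ (2 - 2 * s)) ≤ denom t u ξ :=
    le_trans (by gcongr) (rpow_mul_rpow_le_denom ht hs0.le (by linarith) u ξ)
  have hk := rpow_mul_rpow_le_kernel (a := 1 - α - s) (b := 2 - 2 * s) (by linarith)
    (by linarith) hξ hz0
  have hab : 1 - α - s + (2 - 2 * s) = 3 - α - 3 * s := by ring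
  rw [hab] at hk
  have hT : 0 < t ^ (1 - s) := Real.rpow_pos_of_pos ht _
  calc ‖ξ‖ ^ (α + 1) / denom t u ξ
      ≤ ‖ξ‖ ^ (α + 1) / (‖ξ‖ ^ s * (t ^ (1 - s) * (c * (‖ξ‖ * ‖z‖)) ^ (2 - 2 * s))) := by
        gcongr
    _ = c ^ (-(2 - 2 * s)) * (1 / t ^ (1 - s)) *
        (‖ξ‖ ^ (-(1 - α - s)) * ‖z‖ ^ (-(2 - 2 * s))) := by
        rw [Real.mul_rpow hc.le (by positivity), Real.mul_rpow hr.le hz0'.le,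
          Real.rpow_neg hc.le, Real.rpow_neg hz0'.le]
        have e : ‖ξ‖ ^ (α + 1) = ‖ξ‖ ^ (-(1 - α - s)) * ‖ξ‖ ^ s * ‖ξ‖ ^ (2 - 2 * s) := by
          rw [← Real.rpow_add hr, ← Real.rpow_add hr]; congr 1; ring
        rw [e]
        have : 0 < ‖ξ‖ ^ s := by positivity
        have : 0 < ‖ξ‖ ^ (2 - 2 * s) := by positivity
        field_simp
    _ ≤ _ := by
        gcongr
        linarith

/-- If `|G| ≤ |ξ|²`, the first term on the right suffices. Otherwise `|G|` is large, and the
interpolated denominator leaves a negative power of `|G|`, bounded by the same power of `|ξ|²`. -/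
theorem rpow_mul_norm_phaseGrad_div_denom_le {α s t : ℝ} (ht : 0 < t) (hs0 : 0 < s)
    (hα₀ : 0 ≤ α) (hs1 : s < (1 - α) / 3) (u : ℂ) {ξ : ℂ} (hξ : 1 ≤ ‖ξ‖) :
    ‖ξ‖ ^ (α - 1) * ‖phaseGrad u ξ‖ / denom t u ξ ≤ ‖ξ‖ ^ (α + 1) / denom t u ξ +
      1 / t ^ (1 - s) * kernel (2 - 2 * s) (3 - α - 3 * s) ξ := by
  have hr : 0 < ‖ξ‖ := by linarith
  have hD : 0 < denom t u ξ := hr.trans_le (norm_le_denom ht u ξ)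
  have hT : 0 < t ^ (1 - s) := Real.rpow_pos_of_pos ht _
  rcases le_total ‖phaseGrad u ξ‖ (‖ξ‖ ^ 2) with h | h
  · refine le_add_of_le_of_nonneg ?_ (mul_nonneg (by positivity) (kernel_nonneg _ _ _))
    gcongr
    calc ‖ξ‖ ^ (α - 1) * ‖phaseGrad u ξ‖ ≤ ‖ξ‖ ^ (α - 1) * ‖ξ‖ ^ 2 := by gcongr
      _ = ‖ξ‖ ^ (α + 1) := by
        rw [← Real.rpow_natCast, ← Real.rpow_add hr]; congr 1; push_cast; ring
  · refine le_add_of_nonneg_of_le (by positivity) ?_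
    have he : 0 < ‖phaseGrad u ξ‖ := lt_of_lt_of_le (by positivity) h
    rw [kernel_of_one_le _ _ hξ]
    have h1 := rpow_mul_rpow_le_denom ht hs0.le (by linarith) u ξ
    have h2 : ‖phaseGrad u ξ‖ ^ (-(1 - 2 * s)) ≤ (‖ξ‖ ^ 2) ^ (-(1 - 2 * s)) :=
      Real.rpow_le_rpow_of_nonpos (by positivity) h (by linarith)
    calc _ ≤ ‖ξ‖ ^ (α - 1) * ‖phaseGrad u ξ‖ /
          (‖ξ‖ ^ s * (t ^ (1 - s) * ‖phaseGrad u ξ‖ ^ (2 - 2 * s))) := by gcongr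
      _ = 1 / t ^ (1 - s) * (‖ξ‖ ^ (α - 1 - s) * ‖phaseGrad u ξ‖ ^ (-(1 - 2 * s))) := by
        have e1 : ‖phaseGrad u ξ‖ ^ (-(1 - 2 * s)) =
            ‖phaseGrad u ξ‖ / ‖phaseGrad u ξ‖ ^ (2 - 2 * s) := by
          rw [show -(1 - 2 * s) = 1 - (2 - 2 * s) by ring, Real.rpow_sub he, Real.rpow_one]
        have e2 : ‖ξ‖ ^ (α - 1) = ‖ξ‖ ^ (α - 1 - s) * ‖ξ‖ ^ s := by
          rw [← Real.rpow_add hr]; congr 1; ring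
        rw [e1, e2]
        have : 0 < ‖ξ‖ ^ s := by positivity
        field_simp
      _ ≤ 1 / t ^ (1 - s) * (‖ξ‖ ^ (α - 1 - s) * (‖ξ‖ ^ 2) ^ (-(1 - 2 * s))) := by gcongr
      _ = _ := by
        rw [← Real.rpow_natCast, ← Real.rpow_mul hr.le, ← Real.rpow_add hr]
        congr 2; push_cast; ring

/-- The oscillating factor `exp(i t S̃(u, ξ))`. -/
def oscillation (t : ℝ) (u ξ : ℂ) : ℂ := Complex.exp (Complex.I * (t : ℂ) * phase 1 u ξ)

theorem phase_im (u ξ : ℂ) : (phase 1 u ξ).im = 0 := by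
  rw [← Complex.conj_eq_iff_im]
  simp only [phase, map_mul, map_add, map_sub, map_div₀, map_pow, Complex.conj_conj, map_one,
    map_ofNat, Complex.conj_ofReal]
  ring

theorem norm_oscillation (t : ℝ) (u ξ : ℂ) : ‖oscillation t u ξ‖ = 1 := by
  rw [oscillation, Complex.norm_exp]
  simp [phase_im]

theorem measurable_oscillation (t : ℝ) (u : ℂ) : Measurable (oscillation t u) := by
  have hc : Measurable (fun z : ℂ => conj z) := Complex.continuous_conj.measurable
  unfold oscillation phase
  fun_prop

/-- The divergence of a planar vector field, written as a complex-valued function. -/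
def divergence (W : ℂ → ℂ) (ξ : ℂ) : ℝ := (fderiv ℝ W ξ 1).re + (fderiv ℝ W ξ Complex.I).im

theorem abs_divergence_le (W : ℂ → ℂ) (ξ : ℂ) : |divergence W ξ| ≤ 2 * ‖fderiv ℝ W ξ‖ := by
  have h1 := (Complex.abs_re_le_norm _).trans ((fderiv ℝ W ξ).le_opNorm 1)
  have h2 := (Complex.abs_im_le_norm _).trans ((fderiv ℝ W ξ).le_opNorm Complex.I)
  simp only [norm_one, mul_one, Complex.norm_I] at h1 h2
  refine (abs_add_le _ _).trans ?_
  linarith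

/-- The absolutely integrable function whose integral is the oscillatory integral. -/
def regularIntegrand (α : ℝ) (ψ : ℂ → ℝ) (t : ℝ) (u ξ : ℂ) : ℂ :=
  oscillation t u ξ * (((amplitude α ψ ξ * ‖ξ‖ / denom t u ξ : ℝ) : ℂ) +
    Complex.I * (divergence (field α ψ t u) ξ : ℂ))

theorem IsHighFrequencyCutoff.amplitude_eq_zero {R : ℝ} {ψ : ℂ → ℝ}
    (hψ : IsHighFrequencyCutoff R ψ) (α : ℝ) {ξ : ℂ} (h : ‖ξ‖ ≤ R) : amplitude α ψ ξ = 0 := by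
  simp [amplitude, hψ.eq_zero ξ h]

theorem IsHighFrequencyCutoff.field_eq_zero {R : ℝ} {ψ : ℂ → ℝ}
    (hψ : IsHighFrequencyCutoff R ψ) (α t : ℝ) (u : ℂ) {ξ : ℂ} (h : ‖ξ‖ ≤ R) :
    field α ψ t u ξ = 0 := by
  simp [field, hψ.amplitude_eq_zero α h]

theorem IsHighFrequencyCutoff.contDiff_field {R : ℝ} (hR : 0 < R) {ψ : ℂ → ℝ}
    (hψ : IsHighFrequencyCutoff R ψ) (α : ℝ) {t : ℝ} (ht : 0 < t) (u : ℂ) :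
    ContDiff ℝ ∞ (field α ψ t u) := by
  rw [contDiff_iff_contDiffAt]
  intro ξ
  rcases eq_or_ne ξ 0 with rfl | hξ
  · have : field α ψ t u =ᶠ[𝓝 0] fun _ => 0 := by
      filter_upwards [Metric.ball_mem_nhds (0 : ℂ) hR] with z hz
      exact hψ.field_eq_zero α t u (by simpa using (mem_ball_zero_iff.1 hz).le)
    exact contDiffAt_const.congr_of_eventuallyEq this
  · have hn : ContDiffAt ℝ ∞ (fun z : ℂ => ‖z‖) ξ := contDiffAt_norm ℝ hξ
    have hr : 0 < ‖ξ‖ := norm_pos_iff.2 hξ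
    have hE := contDiffAt_phaseGrad u hξ
    have hD0 : denom t u ξ ≠ 0 := (hr.trans_le (norm_le_denom ht u ξ)).ne'
    have hD : ContDiffAt ℝ ∞ (denom t u) ξ := hn.add (contDiffAt_const.mul (hE.norm_sq ℝ))
    have hA : ContDiffAt ℝ ∞ (amplitude α ψ) ξ :=
      (hn.rpow_const_of_ne hr.ne').mul hψ.smooth.contDiffAt
    exact (hA.mul (hD.inv hD0)).smul
      (Complex.conjCLE.contDiff.contDiffAt.comp ξ hE)

theorem IsHighFrequencyCutoff.exists_norm_regularIntegrand_le {R : ℝ} (hR : 2 < R) {ψ : ℂ → ℝ}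
    (hψ : IsHighFrequencyCutoff R ψ) {α : ℝ} (hα₀ : 0 ≤ α) (hα₁ : α < 1) {s : ℝ} (hs0 : 0 < s)
    (hs1 : s < (1 - α) / 3) :
    ∃ K : ℝ, 0 < K ∧ ∀ t : ℝ, 0 < t → ∀ u : ℂ, ∃ ζ : ℂ, ∀ ξ : ℂ, ξ ≠ ζ → ξ ≠ -ζ →
      ‖regularIntegrand α ψ t u ξ‖ ≤ K * (1 / t ^ (1 - s)) *
        (kernel (2 - 2 * s) (3 - α - 3 * s) ξ + kernel (2 - 2 * s) (3 - α - 3 * s) (ξ - ζ) +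
          kernel (2 - 2 * s) (3 - α - 3 * s) (ξ + ζ)) := by
  have hR0 : 0 < R := by linarith
  obtain ⟨C, hC0, hC⟩ := hψ.exists_norm_fderiv_amplitude_le hR0 hα₀ hα₁
  -- Positivity of this constant is exactly where `R > 2` is needed for nondegeneracy.
  have hc : 0 < 3 * (1 - 4 / R ^ 2) := by
    have : 4 / R ^ 2 < 1 := by rw [div_lt_one (by positivity)]; nlinarith
    linarith
  set c := 3 * (1 - 4 / R ^ 2) with hcdef
  -- Here `145 = 2·72 + 1`: the divergence costs twice the norm of the derivative, and the
  -- undifferentiated term adds 1.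
  refine ⟨(2 * (C + 1) + 145) * c ^ (-(2 - 2 * s)) + 2 * (C + 1), by positivity,
    fun t ht u => ?_⟩
  obtain ⟨ζ, -, hζ⟩ := exists_norm_phaseGrad_ge hR0 u
  refine ⟨ζ, fun ξ h₁ h₂ => ?_⟩
  have hT : 0 < t ^ (1 - s) := Real.rpow_pos_of_pos ht _
  have k1 := kernel_nonneg (2 - 2 * s) (3 - α - 3 * s) ξ
  have k2 := kernel_nonneg (2 - 2 * s) (3 - α - 3 * s) (ξ - ζ)
  have k3 := kernel_nonneg (2 - 2 * s) (3 - α - 3 * s) (ξ + ζ)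
  rw [regularIntegrand, norm_mul, norm_oscillation, one_mul]
  rcases lt_or_ge ‖ξ‖ R with h | h
  · have hW : field α ψ t u =ᶠ[𝓝 ξ] fun _ => 0 := by
      filter_upwards [(isOpen_lt continuous_norm continuous_const).mem_nhds h] with z hz
      exact hψ.field_eq_zero α t u (le_of_lt hz)
    have hd : divergence (field α ψ t u) ξ = 0 := by
      simp [divergence, hW.fderiv_eq]
    rw [hd, hψ.amplitude_eq_zero α h.le]
    simp only [zero_mul, zero_div, Complex.ofReal_zero, mul_zero, add_zero, norm_zero]
    positivity
  · have hξ1 : 1 ≤ ‖ξ‖ := by linarith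
    have hr : 0 < ‖ξ‖ := by linarith
    have hD : 0 < denom t u ξ := hr.trans_le (norm_le_denom ht u ξ)
    have b1 := norm_fderiv_field_le ht u (by linarith : 2 ≤ ‖ξ‖) (hψ.mem_Icc ξ)
      (hψ.smooth.contDiffAt.differentiableAt (by simp)) (hC ξ h)
    have b2 := rpow_div_denom_le_kernel ht hs0 hα₀ hs1 hc u hξ1 h₁ h₂ (hζ ξ h)
    have b3 := rpow_mul_norm_phaseGrad_div_denom_le ht hs0 hα₀ hs1 u hξ1
    have b4 := abs_divergence_le (field α ψ t u) ξ
    have b5 : |amplitude α ψ ξ * ‖ξ‖ / denom t u ξ| ≤ ‖ξ‖ ^ (α + 1) / denom t u ξ := by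
      have h0 := hψ.mem_Icc ξ
      rw [amplitude, abs_of_nonneg (div_nonneg (mul_nonneg (mul_nonneg (by positivity) h0.1)
        (norm_nonneg _)) hD.le), Real.rpow_add_one hr.ne']
      gcongr
      exact mul_le_of_le_one_right (by positivity) h0.2
    have b6 : ‖((amplitude α ψ ξ * ‖ξ‖ / denom t u ξ : ℝ) : ℂ) +
        Complex.I * (divergence (field α ψ t u) ξ : ℂ)‖ ≤
        |amplitude α ψ ξ * ‖ξ‖ / denom t u ξ| + |divergence (field α ψ t u) ξ| := by
      refine (norm_add_le _ _).trans ?_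
      rw [norm_mul, Complex.norm_I, one_mul, Complex.norm_real, Complex.norm_real,
        Real.norm_eq_abs, Real.norm_eq_abs]
    have b7 : 1 / t ^ (1 - s) * kernel (2 - 2 * s) (3 - α - 3 * s) ξ ≤ 1 / t ^ (1 - s) *
        (kernel (2 - 2 * s) (3 - α - 3 * s) ξ + kernel (2 - 2 * s) (3 - α - 3 * s) (ξ - ζ) +
          kernel (2 - 2 * s) (3 - α - 3 * s) (ξ + ζ)) := by
      gcongr; linarith
    set X := ‖ξ‖ ^ (α + 1) / denom t u ξ
    set Y := ‖ξ‖ ^ (α - 1) * ‖phaseGrad u ξ‖ / denom t u ξ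
    set Z := kernel (2 - 2 * s) (3 - α - 3 * s) ξ + kernel (2 - 2 * s) (3 - α - 3 * s) (ξ - ζ) +
          kernel (2 - 2 * s) (3 - α - 3 * s) (ξ + ζ)
    have b8 : (C + 1) * Y ≤ (C + 1) * (X + 1 / t ^ (1 - s) * Z) :=
      mul_le_mul_of_nonneg_left (b3.trans (by linarith)) (by linarith)
    have b9 : (2 * (C + 1) + 145) * X ≤
        (2 * (C + 1) + 145) * (c ^ (-(2 - 2 * s)) * (1 / t ^ (1 - s)) * Z) :=
      mul_le_mul_of_nonneg_left b2 (by linarith)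
    calc _ ≤ (2 * (C + 1) + 145) * X + 2 * (C + 1) * (1 / t ^ (1 - s) * Z) := by linarith
      _ ≤ _ := by linarith

/-! ### Integration by parts -/

theorem hasFDerivAt_oscillation (t : ℝ) (u : ℂ) {ξ : ℂ} (hξ : ξ ≠ 0) :
    HasFDerivAt (oscillation t u)
      (oscillation t u ξ • ((Complex.I * t) • fderiv ℝ (phase 1 u) ξ)) ξ :=
  (((contDiffAt_phase u hξ).differentiableAt (by simp)).hasFDerivAt.const_mul
    (Complex.I * (t : ℂ))).cexp

theorem integrable_oscillation_mul (t : ℝ) (u : ℂ) {h : ℂ → ℂ} (hh : Continuous h)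
    (hs : HasCompactSupport h) : Integrable fun ξ => oscillation t u ξ * h ξ :=
  (hh.integrable_of_hasCompactSupport hs).bdd_mul (c := 1)
    (measurable_oscillation t u).aestronglyMeasurable
    (Eventually.of_forall fun ξ => (norm_oscillation t u ξ).le)

/-- Integration by parts against the oscillating factor, in a fixed direction `v`. -/
theorem integral_oscillation_mul_fderiv {R : ℝ} (hR : 0 < R) (t : ℝ) (u v : ℂ) {h : ℂ → ℝ}
    (hh : ContDiff ℝ 1 h) (hs : HasCompactSupport h) (h0 : ∀ ξ : ℂ, ‖ξ‖ ≤ R → h ξ = 0) :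
    (Integrable fun ξ => oscillation t u ξ * ((fderiv ℝ h ξ v : ℝ) : ℂ)) ∧
    (Integrable fun ξ => oscillation t u ξ *
      (Complex.I * t * (((phaseGrad u ξ * v).re * h ξ : ℝ) : ℂ))) ∧
    ∫ ξ, oscillation t u ξ * ((fderiv ℝ h ξ v : ℝ) : ℂ) =
      - ∫ ξ, oscillation t u ξ * (Complex.I * t * (((phaseGrad u ξ * v).re * h ξ : ℝ) : ℂ)) := by
  have hhc : HasCompactSupport fun ξ => (h ξ : ℂ) := hs.comp_left Complex.ofReal_zero
  have hcont : Continuous fun ξ => (phaseGrad u ξ * v).re * h ξ := by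
    rw [continuous_iff_continuousAt]
    intro ξ
    rcases eq_or_ne ξ 0 with rfl | hξ
    · have : (fun ξ => (phaseGrad u ξ * v).re * h ξ) =ᶠ[𝓝 0] fun _ => 0 := by
        filter_upwards [Metric.ball_mem_nhds (0 : ℂ) hR] with z hz
        rw [h0 z (by simpa using (mem_ball_zero_iff.1 hz).le), mul_zero]
      exact continuousAt_const.congr this.symm
    · exact (Complex.continuous_re.continuousAt.comp
        ((contDiffAt_phaseGrad u hξ).continuousAt.mul continuousAt_const)).mul
        hh.continuous.continuousAt
  have i1 : Integrable fun ξ => oscillation t u ξ * ((fderiv ℝ h ξ v : ℝ) : ℂ) :=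
    integrable_oscillation_mul t u
      (Complex.continuous_ofReal.comp ((hh.continuous_fderiv (by simp)).clm_apply continuous_const))
      ((hs.fderiv_apply (𝕜 := ℝ) v).comp_left Complex.ofReal_zero)
  have i2 : Integrable fun ξ => oscillation t u ξ *
      (Complex.I * t * (((phaseGrad u ξ * v).re * h ξ : ℝ) : ℂ)) :=
    integrable_oscillation_mul t u (continuous_const.mul (Complex.continuous_ofReal.comp hcont))
      ((hs.mul_left.comp_left Complex.ofReal_zero).mul_left)
  have i3 : Integrable fun ξ => oscillation t u ξ * (h ξ : ℂ) :=
    integrable_oscillation_mul t u (Complex.continuous_ofReal.comp hh.continuous) hhc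
  -- The phase is singular at the origin, so its derivative is needed only on the closed support of
  -- `h`, which avoids it.
  have hne : ∀ ξ ∈ tsupport (fun ξ => (h ξ : ℂ)), ξ ≠ 0 := by
    rintro ξ hξ rfl
    refine (notMem_tsupport_iff_eventuallyEq.2 ?_) hξ
    filter_upwards [Metric.ball_mem_nhds (0 : ℂ) hR] with z hz
    simp [h0 z (by simpa using (mem_ball_zero_iff.1 hz).le)]
  have hf' : ∀ ξ, (oscillation t u ξ • ((Complex.I * t) • fderiv ℝ (phase 1 u) ξ)) v * (h ξ : ℂ) =
      oscillation t u ξ * (Complex.I * t * (((phaseGrad u ξ * v).re * h ξ : ℝ) : ℂ)) := by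
    intro ξ
    rcases eq_or_ne ξ 0 with rfl | hξ
    · simp [h0 0 (by simpa using hR.le)]
    · simp only [_root_.smul_apply, smul_eq_mul, fderiv_phase_apply u hξ]
      push_cast
      ring
  refine ⟨i1, i2, ?_⟩
  have key := integral_bilinear_hasFDerivAt_right_eq_neg_left_of_integrable (μ := volume)
    (f := oscillation t u) (g := fun ξ => (h ξ : ℂ)) (v := v)
    (f' := fun ξ => oscillation t u ξ • ((Complex.I * t) • fderiv ℝ (phase 1 u) ξ))
    (g' := fun ξ => Complex.ofRealCLM.comp (fderiv ℝ h ξ))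
    (B := ContinuousLinearMap.mul ℝ ℂ) (by simpa only [ContinuousLinearMap.mul_apply', hf'] using i2)
    (by simpa using i1) (by simpa using i3)
    (fun ξ hξ => hasFDerivAt_oscillation t u (hne ξ hξ))
    (fun ξ _ => Complex.ofRealCLM.hasFDerivAt.comp ξ
      (hh.contDiffAt.differentiableAt (by simp)).hasFDerivAt)
  simpa only [ContinuousLinearMap.mul_apply', hf', ContinuousLinearMap.comp_apply,
    Complex.ofRealCLM_apply] using key

/-- The pairing of the differential of `η` with the vector field `W`. -/
def fderivAlong (η : ℂ → ℝ) (W : ℂ → ℂ) (ξ : ℂ) : ℝ :=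
  fderiv ℝ η ξ 1 * (W ξ).re + fderiv ℝ η ξ Complex.I * (W ξ).im

theorem abs_fderivAlong_le (η : ℂ → ℝ) (W : ℂ → ℂ) (ξ : ℂ) :
    |fderivAlong η W ξ| ≤ 2 * ‖fderiv ℝ η ξ‖ * ‖W ξ‖ := by
  have h1 := (fderiv ℝ η ξ).le_opNorm 1
  have h2 := (fderiv ℝ η ξ).le_opNorm Complex.I
  simp only [norm_one, mul_one, Complex.norm_I, Real.norm_eq_abs] at h1 h2
  refine (abs_add_le _ _).trans ?_
  rw [abs_mul, abs_mul]
  have := mul_le_mul h1 (Complex.abs_re_le_norm (W ξ)) (abs_nonneg _) (norm_nonneg _)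
  have := mul_le_mul h2 (Complex.abs_im_le_norm (W ξ)) (abs_nonneg _) (norm_nonneg _)
  linarith

theorem re_mul_field (α : ℝ) (ψ : ℂ → ℝ) (t : ℝ) (u ξ : ℂ) :
    (phaseGrad u ξ * 1).re * (field α ψ t u ξ).re +
      (phaseGrad u ξ * Complex.I).re * (field α ψ t u ξ).im =
      amplitude α ψ ξ * (denom t u ξ)⁻¹ * ‖phaseGrad u ξ‖ ^ 2 := by
  rw [Complex.sq_norm, Complex.normSq_apply]
  simp [field]
  ring

/-- The compactly supported field `ηW` is integrated by parts in the two coordinate directions. The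
only trace of the truncation is the term where the derivative falls on `η`. -/
theorem integral_cutoff_mul_integrand {R : ℝ} (hR : 0 < R) {ψ : ℂ → ℝ}
    (hψ : IsHighFrequencyCutoff R ψ) (α : ℝ) {t : ℝ} (ht : 0 < t) (u : ℂ) {η : ℂ → ℝ}
    (hη : ContDiff ℝ 1 η) (hηs : HasCompactSupport η)
    (hg : Integrable (regularIntegrand α ψ t u)) :
    ∫ ξ, (η ξ : ℂ) * integrand α ψ t u ξ =
      (∫ ξ, (η ξ : ℂ) * regularIntegrand α ψ t u ξ) +
        ∫ ξ, Complex.I * (oscillation t u ξ * (fderivAlong η (field α ψ t u) ξ : ℂ)) := by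
  set W := field α ψ t u with hWdef
  have hW : ContDiff ℝ 1 W := (hψ.contDiff_field hR α ht u).of_le (by simp)
  have hre : ContDiff ℝ 1 fun ξ => (W ξ).re := Complex.reCLM.contDiff.comp hW
  have him : ContDiff ℝ 1 fun ξ => (W ξ).im := Complex.imCLM.contDiff.comp hW
  obtain ⟨a1, a2, a3⟩ := integral_oscillation_mul_fderiv hR t u 1 (hη.mul hre) hηs.mul_right
    (fun ξ hξ => by simp [hWdef, hψ.field_eq_zero α t u hξ])
  obtain ⟨b1, b2, b3⟩ := integral_oscillation_mul_fderiv hR t u Complex.I (hη.mul him)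
    hηs.mul_right (fun ξ hξ => by simp [hWdef, hψ.field_eq_zero α t u hξ])
  have hηd : ∀ ξ, HasFDerivAt η (fderiv ℝ η ξ) ξ := fun ξ =>
    (hη.contDiffAt.differentiableAt (by simp)).hasFDerivAt
  have hWd : ∀ ξ, HasFDerivAt W (fderiv ℝ W ξ) ξ := fun ξ =>
    (hW.contDiffAt.differentiableAt (by simp)).hasFDerivAt
  have d1 : ∀ ξ v, fderiv ℝ (fun x => η x * (W x).re) ξ v =
      η ξ * (fderiv ℝ W ξ v).re + fderiv ℝ η ξ v * (W ξ).re := fun ξ v => by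
    have h' : HasFDerivAt (fun x => (W x).re) (Complex.reCLM.comp (fderiv ℝ W ξ)) ξ :=
      Complex.reCLM.hasFDerivAt.comp ξ (hWd ξ)
    rw [((hηd ξ).fun_mul h').fderiv]
    simp [mul_comm]
  have d2 : ∀ ξ v, fderiv ℝ (fun x => η x * (W x).im) ξ v =
      η ξ * (fderiv ℝ W ξ v).im + fderiv ℝ η ξ v * (W ξ).im := fun ξ v => by
    have h' : HasFDerivAt (fun x => (W x).im) (Complex.imCLM.comp (fderiv ℝ W ξ)) ξ :=
      Complex.imCLM.hasFDerivAt.comp ξ (hWd ξ)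
    rw [((hηd ξ).fun_mul h').fderiv]
    simp [mul_comm]
  have hdiv : (∫ ξ, oscillation t u ξ * ((η ξ * divergence W ξ + fderivAlong η W ξ : ℝ) : ℂ)) =
      -∫ ξ, oscillation t u ξ * (Complex.I * t *
        ((η ξ * (amplitude α ψ ξ * (denom t u ξ)⁻¹ * ‖phaseGrad u ξ‖ ^ 2) : ℝ) : ℂ)) := by
    have e1 := integral_add a1 b1
    have e2 := integral_add a2 b2
    rw [a3, b3, ← neg_add, ← e2] at e1
    refine (integral_congr_ae (Eventually.of_forall fun ξ => ?_)).trans (e1.trans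
      (congrArg _ (integral_congr_ae (Eventually.of_forall fun ξ => ?_))))
    · rw [d1, d2, divergence, fderivAlong]
      push_cast
      ring
    · beta_reduce
      rw [← re_mul_field, ← hWdef]
      push_cast
      ring
  have hηb : ∃ M, ∀ ξ, ‖(η ξ : ℂ)‖ ≤ M := by
    obtain ⟨M, hM⟩ := hη.continuous.bounded_above_of_compact_support hηs
    exact ⟨M, fun ξ => by simpa using hM ξ⟩
  obtain ⟨M, hM⟩ := hηb
  have j1 : Integrable fun ξ => (η ξ : ℂ) * regularIntegrand α ψ t u ξ :=
    hg.bdd_mul (Complex.continuous_ofReal.comp hη.continuous).aestronglyMeasurable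
      (Eventually.of_forall hM)
  have j2 : Integrable fun ξ =>
      Complex.I * (oscillation t u ξ * (fderivAlong η W ξ : ℂ)) := by
    refine (integrable_oscillation_mul t u (Complex.continuous_ofReal.comp ?_)
      (HasCompactSupport.comp_left ?_ Complex.ofReal_zero)).const_mul _
    · have hdη := hη.continuous_fderiv (by simp)
      exact ((hdη.clm_apply continuous_const).mul hre.continuous).add
        ((hdη.clm_apply continuous_const).mul him.continuous)
    · exact (HasCompactSupport.mul_right (hηs.fderiv_apply (𝕜 := ℝ) 1)).add
        (HasCompactSupport.mul_right (hηs.fderiv_apply (𝕜 := ℝ) Complex.I))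
  have j3 : Integrable fun ξ => oscillation t u ξ * (Complex.I * t *
        ((η ξ * (amplitude α ψ ξ * (denom t u ξ)⁻¹ * ‖phaseGrad u ξ‖ ^ 2) : ℝ) : ℂ)) := by
    refine (a2.add b2).congr (Eventually.of_forall fun ξ => ?_)
    simp only [Pi.add_apply]
    rw [← re_mul_field, ← hWdef]
    push_cast
    ring
  have j4 : Integrable fun ξ =>
      oscillation t u ξ * ((η ξ * divergence W ξ + fderivAlong η W ξ : ℝ) : ℂ) := by
    refine (a1.add b1).congr (Eventually.of_forall fun ξ => ?_)
    simp only [Pi.add_apply]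
    rw [d1, d2, divergence, fderivAlong]
    push_cast
    ring
  -- The last bracket has integral zero by `hdiv`.
  have hsplit : ∀ ξ, (η ξ : ℂ) * integrand α ψ t u ξ =
      (η ξ : ℂ) * regularIntegrand α ψ t u ξ +
      Complex.I * (oscillation t u ξ * (fderivAlong η W ξ : ℂ)) +
      (-Complex.I) * (oscillation t u ξ * ((η ξ * divergence W ξ + fderivAlong η W ξ : ℝ) : ℂ) +
        oscillation t u ξ * (Complex.I * t *
        ((η ξ * (amplitude α ψ ξ * (denom t u ξ)⁻¹ * ‖phaseGrad u ξ‖ ^ 2) : ℝ) : ℂ))) := by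
    intro ξ
    -- This is the partition `1 = |ξ|/D + t|G|²/D`; at the origin the amplitude vanishes.
    have hA : amplitude α ψ ξ = amplitude α ψ ξ * ‖ξ‖ / denom t u ξ +
        t * (amplitude α ψ ξ * (denom t u ξ)⁻¹ * ‖phaseGrad u ξ‖ ^ 2) := by
      rcases eq_or_ne ξ 0 with rfl | hξ
      · simp [hψ.amplitude_eq_zero α (show ‖(0 : ℂ)‖ ≤ R by simpa using hR.le)]
      · have hD : denom t u ξ ≠ 0 := ((norm_pos_iff.2 hξ).trans_le (norm_le_denom ht u ξ)).ne'
        field_simp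
        rw [denom]
    have hA' := congrArg (fun x : ℝ => (x : ℂ)) hA
    push_cast at hA'
    have hint : integrand α ψ t u ξ = (amplitude α ψ ξ : ℂ) * oscillation t u ξ := rfl
    rw [hint, regularIntegrand, ← hWdef]
    push_cast
    linear_combination (η ξ : ℂ) * oscillation t u ξ * hA' +
      (η ξ : ℂ) * oscillation t u ξ * (t * (amplitude α ψ ξ * (denom t u ξ : ℂ)⁻¹ *
        (‖phaseGrad u ξ‖ : ℂ) ^ 2)) * Complex.I_sq
  simp_rw [hsplit]
  have hsum := integral_add (j1.add j2) ((j4.add j3).const_mul (-Complex.I))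
  simp only [Pi.add_apply] at hsum
  rw [hsum, integral_add j1 j2,
    integral_const_mul (-Complex.I), integral_add j4 j3, hdiv]
  ring

/-! ### Truncation to discs -/

theorem exists_abs_deriv_smoothTransition_le :
    ∃ M : ℝ, 0 ≤ M ∧ (∀ x, |deriv Real.smoothTransition x| ≤ M) ∧
      ∀ x, x ∉ Ioo (0 : ℝ) 1 → deriv Real.smoothTransition x = 0 := by
  have hz : ∀ x, x ∉ Ioo (0 : ℝ) 1 → deriv Real.smoothTransition x = 0 := by
    intro x hx
    rcases le_or_gt x 0 with h | h
    -- Extremality gives a zero derivative at the endpoint of the interval as well.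
    · refine IsLocalMin.deriv_eq_zero (Eventually.of_forall fun y => ?_)
      rw [Real.smoothTransition.zero_of_nonpos h]
      exact Real.smoothTransition.nonneg y
    · have h1 : 1 ≤ x := by
        by_contra h1
        exact hx ⟨h, not_le.1 h1⟩
      refine IsLocalMax.deriv_eq_zero (Eventually.of_forall fun y => ?_)
      rw [Real.smoothTransition.one_of_one_le h1]
      exact Real.smoothTransition.le_one y
  have hc : Continuous (deriv Real.smoothTransition) :=
    (Real.smoothTransition.contDiff (n := 1)).continuous_deriv (by simp)
  obtain ⟨M, hM⟩ := (isCompact_Icc (a := (0 : ℝ)) (b := 1)).exists_bound_of_continuousOn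
    hc.continuousOn
  have hM0 : 0 ≤ M := (norm_nonneg _).trans (hM 0 (by simp))
  refine ⟨M, hM0, fun x => ?_, hz⟩
  by_cases hx : x ∈ Ioo (0 : ℝ) 1
  · exact hM x (Ioo_subset_Icc_self hx)
  · rw [hz x hx, abs_zero]; exact hM0

/-- A smooth approximation of the indicator of the disc of radius `ρ`, with a transition layer of
width comparable to `ρ⁻²`. -/
def discCutoff (ρ : ℝ) (ξ : ℂ) : ℝ := Real.smoothTransition (1 + (ρ ^ 2 - ‖ξ‖ ^ 2) * ρ)

/-- The transition layer of `discCutoff ρ`. -/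
def transitionLayer (ρ : ℝ) : Set ℂ :=
  Metric.ball 0 (Real.sqrt (ρ ^ 2 + 1 / ρ)) \ Metric.closedBall 0 ρ

theorem contDiff_discCutoff (ρ : ℝ) : ContDiff ℝ 1 (discCutoff ρ) :=
  Real.smoothTransition.contDiff.comp (contDiff_const.add
    ((contDiff_const.sub (contDiff_norm_sq ℝ)).mul contDiff_const))

theorem discCutoff_mem_Icc (ρ : ℝ) (ξ : ℂ) : discCutoff ρ ξ ∈ Icc (0 : ℝ) 1 :=
  ⟨Real.smoothTransition.nonneg _, Real.smoothTransition.le_one _⟩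

theorem discCutoff_eq_one {ρ : ℝ} (hρ : 0 < ρ) {ξ : ℂ} (h : ‖ξ‖ ≤ ρ) : discCutoff ρ ξ = 1 := by
  refine Real.smoothTransition.one_of_one_le ?_
  have : ‖ξ‖ ^ 2 ≤ ρ ^ 2 := by gcongr
  nlinarith

theorem mem_transitionLayer {ρ : ℝ} (hρ : 0 < ρ) {ξ : ℂ} :
    ξ ∈ transitionLayer ρ ↔ 1 + (ρ ^ 2 - ‖ξ‖ ^ 2) * ρ ∈ Ioo (0 : ℝ) 1 := by
  have h1 : ‖ξ‖ < Real.sqrt (ρ ^ 2 + 1 / ρ) ↔ 0 < 1 + (ρ ^ 2 - ‖ξ‖ ^ 2) * ρ := by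
    rw [Real.lt_sqrt (norm_nonneg _)]
    constructor
    · intro h
      have := mul_lt_mul_of_pos_right h hρ
      rw [add_mul, one_div, inv_mul_cancel₀ hρ.ne'] at this
      linarith
    · intro h
      refine lt_of_mul_lt_mul_right (a := ρ) ?_ hρ.le
      rw [add_mul, one_div, inv_mul_cancel₀ hρ.ne']
      linarith
  have h2 : ¬ ‖ξ‖ ≤ ρ ↔ 1 + (ρ ^ 2 - ‖ξ‖ ^ 2) * ρ < 1 := by
    rw [not_le, ← sq_lt_sq₀ hρ.le (norm_nonneg _)]
    constructor
    · intro h; nlinarith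
    · intro h; by_contra hc; nlinarith
  simp only [transitionLayer, Set.mem_sdiff, mem_ball_zero_iff, mem_closedBall_zero_iff, mem_Ioo, h1, h2]

theorem discCutoff_eq_zero {ρ : ℝ} (hρ : 0 < ρ) {ξ : ℂ} (h : ρ < ‖ξ‖)
    (h' : ξ ∉ transitionLayer ρ) : discCutoff ρ ξ = 0 := by
  rw [mem_transitionLayer hρ, mem_Ioo, not_and_or] at h'
  refine Real.smoothTransition.zero_of_nonpos ?_
  rcases h' with h' | h'
  · linarith
  · have h2 : ρ ^ 2 < ‖ξ‖ ^ 2 := by gcongr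
    exact absurd (by nlinarith) h'

theorem norm_le_of_mem_transitionLayer {ρ : ℝ} (hρ : 1 ≤ ρ) {ξ : ℂ}
    (h : ξ ∈ transitionLayer ρ) : ρ < ‖ξ‖ ∧ ‖ξ‖ ≤ 2 * ρ := by
  refine ⟨by simpa using h.2, ?_⟩
  have h1 := ((mem_transitionLayer (by linarith)).1 h).1
  by_contra hc
  push Not at hc
  have : (2 * ρ) ^ 2 < ‖ξ‖ ^ 2 := by gcongr
  have h2 : (ρ ^ 2 - ‖ξ‖ ^ 2) ≤ -3 := by nlinarith
  nlinarith

theorem hasCompactSupport_discCutoff {ρ : ℝ} (hρ : 1 ≤ ρ) : HasCompactSupport (discCutoff ρ) := by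
  refine HasCompactSupport.of_support_subset_isCompact (isCompact_closedBall (0 : ℂ) (2 * ρ)) ?_
  intro ξ hξ
  rw [mem_closedBall_zero_iff]
  by_contra hc
  push Not at hc
  refine hξ (discCutoff_eq_zero (by linarith) (by linarith) fun h => ?_)
  exact absurd (norm_le_of_mem_transitionLayer hρ h).2 (not_le.2 hc)

/-- The outer radius is chosen so that the squared radii differ by exactly `1/ρ`. This area beats
both the `ρ^α` growth of the integrand and the `ρ²·ρ^(α-2)` size of the boundary term. -/
theorem volume_transitionLayer {ρ : ℝ} (hρ : 0 < ρ) :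
    volume (transitionLayer ρ) = ENNReal.ofReal (Real.pi / ρ) := by
  have hsub : Metric.closedBall (0 : ℂ) ρ ⊆ Metric.ball 0 (Real.sqrt (ρ ^ 2 + 1 / ρ)) := by
    refine Metric.closedBall_subset_ball (Real.lt_sqrt_of_sq_lt ?_)
    have : 0 < 1 / ρ := by positivity
    linarith
  rw [transitionLayer, measure_sdiff hsub measurableSet_closedBall.nullMeasurableSet
    (by simp [Complex.volume_closedBall, ENNReal.mul_eq_top]), Complex.volume_ball,
    Complex.volume_closedBall, ← ENNReal.ofReal_pow (Real.sqrt_nonneg _),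
    ← ENNReal.ofReal_pow hρ.le, Real.sq_sqrt (by positivity)]
  have hpi : (NNReal.pi : ENNReal) = ENNReal.ofReal Real.pi := by
    rw [← NNReal.coe_real_pi, ENNReal.ofReal_coe_nnreal]
  rw [hpi, ← ENNReal.ofReal_mul (by positivity), ← ENNReal.ofReal_mul (by positivity),
    ← ENNReal.ofReal_sub _ (by positivity)]
  congr 1
  ring

theorem norm_integral_le_of_transitionLayer {ρ : ℝ} (hρ : 0 < ρ) {F : ℂ → ℂ} {B : ℝ}
    (h0 : ∀ ξ, ξ ∉ transitionLayer ρ → F ξ = 0) (hB : ∀ ξ ∈ transitionLayer ρ, ‖F ξ‖ ≤ B) :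
    ‖∫ ξ, F ξ‖ ≤ B * (Real.pi / ρ) := by
  rw [← setIntegral_eq_integral_of_forall_compl_eq_zero h0]
  have hv := volume_transitionLayer hρ
  refine (norm_setIntegral_le_of_norm_le_const (by rw [hv]; exact ENNReal.ofReal_lt_top) hB).trans
    (le_of_eq ?_)
  rw [Measure.real, hv, ENNReal.toReal_ofReal (by positivity)]

theorem exists_norm_fderiv_discCutoff_le :
    ∃ M : ℝ, 0 ≤ M ∧ ∀ ρ : ℝ, 1 ≤ ρ → ∀ ξ : ℂ,
      (ξ ∉ transitionLayer ρ → fderiv ℝ (discCutoff ρ) ξ = 0) ∧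
      (ξ ∈ transitionLayer ρ → ‖fderiv ℝ (discCutoff ρ) ξ‖ ≤ M * ρ ^ 2) := by
  obtain ⟨M, hM0, hM, hz⟩ := exists_abs_deriv_smoothTransition_le
  refine ⟨4 * M, by positivity, fun ρ hρ ξ => ?_⟩
  have hρ0 : 0 < ρ := by linarith
  have h1 : HasFDerivAt (fun z : ℂ => 1 + (ρ ^ 2 - ‖z‖ ^ 2) * ρ) _ ξ :=
    ((((hasFDerivAt_id ξ).norm_sq).const_sub (ρ ^ 2)).mul_const ρ).const_add 1
  have h2 : HasFDerivAt (discCutoff ρ) _ ξ :=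
    ((Real.smoothTransition.contDiff (n := 1)).differentiable (by simp) _).hasDerivAt.comp_hasFDerivAt
      ξ h1
  rw [h2.fderiv]
  refine ⟨fun h => ?_, fun h => ?_⟩
  · rw [hz _ (mt (mem_transitionLayer hρ0).2 h), zero_smul]
  · have hb := (norm_le_of_mem_transitionLayer hρ h).2
    rw [norm_smul, norm_smul, norm_neg, Real.norm_eq_abs, Real.norm_eq_abs, abs_of_pos hρ0]
    have h3 : ‖2 • ((innerSL ℝ) (id ξ)).comp (ContinuousLinearMap.id ℝ ℂ)‖ ≤ 2 * (2 * ρ) := by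
      rw [ContinuousLinearMap.comp_id, two_smul, two_mul]
      refine (norm_add_le _ _).trans ?_
      rw [innerSL_apply_norm]
      exact add_le_add hb hb
    calc _ ≤ M * (ρ * (2 * (2 * ρ))) := by
          gcongr
          exact hM _
      _ = _ := by ring

/-! ### Behaviour at infinity and convergence over discs -/

theorem IsHighFrequencyCutoff.norm_integrand_le {R : ℝ} {ψ : ℂ → ℝ}
    (hψ : IsHighFrequencyCutoff R ψ) (α t : ℝ) (u ξ : ℂ) :
    ‖integrand α ψ t u ξ‖ ≤ ‖ξ‖ ^ α := by
  have h : integrand α ψ t u ξ = (amplitude α ψ ξ : ℂ) * oscillation t u ξ := rfl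
  have hm := hψ.mem_Icc ξ
  rw [h, norm_mul, norm_oscillation, mul_one, Complex.norm_real, Real.norm_eq_abs, amplitude,
    abs_of_nonneg (mul_nonneg (by positivity) hm.1)]
  exact mul_le_of_le_one_right (by positivity) hm.2

/-- Far out, `|G| ≥ |ξ|²`, while `D ≥ t|G|²` bounds the field by `|ξ|^α/(t|G|)`. The threshold
depends on `u`, which is harmless: the bound serves only to identify the limit. -/
theorem IsHighFrequencyCutoff.norm_field_le {R : ℝ} {ψ : ℂ → ℝ}
    (hψ : IsHighFrequencyCutoff R ψ) (α : ℝ) {t : ℝ} (ht : 0 < t) (u : ℂ) {ξ : ℂ}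
    (hξ : 4 + ‖u‖ ≤ ‖ξ‖) : ‖field α ψ t u ξ‖ ≤ ‖ξ‖ ^ (α - 2) / t := by
  have hu := norm_nonneg u
  have hr : 0 < ‖ξ‖ := by linarith
  have hE : ‖ξ‖ ^ 2 ≤ ‖phaseGrad u ξ‖ :=
    le_trans (by nlinarith) (norm_phaseGrad_ge u (norm_pos_iff.1 hr))
  have he : 0 < ‖phaseGrad u ξ‖ := lt_of_lt_of_le (by positivity) hE
  have hm := hψ.mem_Icc ξ
  have hD : 0 < denom t u ξ := hr.trans_le (norm_le_denom ht u ξ)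
  have hD' := mul_sq_le_denom t u ξ
  rw [field, norm_smul, RCLike.norm_conj, Real.norm_eq_abs, amplitude,
    abs_of_nonneg (mul_nonneg (mul_nonneg (by positivity) hm.1) (by positivity))]
  calc ‖ξ‖ ^ α * ψ ξ * (denom t u ξ)⁻¹ * ‖phaseGrad u ξ‖
      ≤ ‖ξ‖ ^ α * 1 * (t * ‖phaseGrad u ξ‖ ^ 2)⁻¹ * ‖phaseGrad u ξ‖ := by
        have := hm.1
        have := hm.2
        gcongr
    _ = ‖ξ‖ ^ α / t / ‖phaseGrad u ξ‖ := by field_simp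
    _ ≤ ‖ξ‖ ^ α / t / ‖ξ‖ ^ 2 := by gcongr
    _ = _ := by
        rw [Real.rpow_sub hr, Real.rpow_ofNat]
        ring

theorem tendsto_integral_discCutoff_mul {g : ℂ → ℂ} (hg : Integrable g) :
    Tendsto (fun ρ : ℝ => ∫ ξ, (discCutoff ρ ξ : ℂ) * g ξ) atTop (𝓝 (∫ ξ, g ξ)) := by
  refine tendsto_integral_filter_of_dominated_convergence (fun ξ => ‖g ξ‖) ?_ ?_ hg.norm ?_
  · exact Eventually.of_forall fun ρ => (Complex.continuous_ofReal.comp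
      (contDiff_discCutoff ρ).continuous).aestronglyMeasurable.mul hg.aestronglyMeasurable
  · refine Eventually.of_forall fun ρ => Eventually.of_forall fun ξ => ?_
    have := discCutoff_mem_Icc ρ ξ
    rw [norm_mul, Complex.norm_real, Real.norm_eq_abs, abs_of_nonneg this.1]
    exact mul_le_of_le_one_left (norm_nonneg _) this.2
  · refine Eventually.of_forall fun ξ => tendsto_const_nhds.congr' ?_
    filter_upwards [eventually_ge_atTop ‖ξ‖, eventually_gt_atTop 0] with ρ hρ hρ0
    rw [discCutoff_eq_one hρ0 hρ]; simp

theorem tendsto_const_mul_rpow_sub_one {α : ℝ} (hα : α < 1) (c : ℝ) :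
    Tendsto (fun ρ : ℝ => c * ρ ^ (α - 1)) atTop (𝓝 0) := by
  have h := tendsto_rpow_neg_atTop (y := 1 - α) (by linarith)
  rw [neg_sub] at h
  simpa using h.const_mul c

theorem IsHighFrequencyCutoff.measurable_integrand {R : ℝ} {ψ : ℂ → ℝ}
    (hψ : IsHighFrequencyCutoff R ψ) (α t : ℝ) (u : ℂ) :
    Measurable (integrand α ψ t u) := by
  have h : integrand α ψ t u = fun ξ => (amplitude α ψ ξ : ℂ) * oscillation t u ξ := rfl
  rw [h]
  have hm := hψ.smooth.continuous.measurable
  have := measurable_oscillation t u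
  unfold amplitude
  fun_prop

/-- The oscillatory integral exists as soon as the regularised integrand is integrable. -/
theorem IsHighFrequencyCutoff.hasOscillatoryIntegral {R : ℝ} (hR : 0 < R) {ψ : ℂ → ℝ}
    (hψ : IsHighFrequencyCutoff R ψ) {α : ℝ} (hα₀ : 0 ≤ α) (hα₁ : α < 1) {t : ℝ} (ht : 0 < t)
    (u : ℂ) (hg : Integrable (regularIntegrand α ψ t u)) :
    HasOscillatoryIntegral (integrand α ψ t u) (∫ ξ, regularIntegrand α ψ t u ξ) := by
  obtain ⟨M, hM0, hM⟩ := exists_norm_fderiv_discCutoff_le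
  have hboundary : Tendsto (fun ρ : ℝ => ∫ ξ, Complex.I * (oscillation t u ξ *
      (fderivAlong (discCutoff ρ) (field α ψ t u) ξ : ℂ))) atTop (𝓝 0) := by
    refine squeeze_zero_norm' ?_ (tendsto_const_mul_rpow_sub_one hα₁ (2 * M * Real.pi / t))
    filter_upwards [eventually_ge_atTop (4 + ‖u‖)] with ρ hρ
    have hρ1 : 1 ≤ ρ := by linarith [norm_nonneg u]
    have hρ0 : 0 < ρ := by linarith
    refine (norm_integral_le_of_transitionLayer hρ0 (B := 2 * (M * ρ ^ 2) * (ρ ^ (α - 2) / t))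
      (fun ξ hξ => ?_) (fun ξ hξ => ?_)).trans (le_of_eq ?_)
    · simp [fderivAlong, (hM ρ hρ1 ξ).1 hξ]
    · have hlt := (norm_le_of_mem_transitionLayer hρ1 hξ).1
      rw [norm_mul, norm_mul, Complex.norm_I, norm_oscillation, one_mul, one_mul,
        Complex.norm_real, Real.norm_eq_abs]
      refine (abs_fderivAlong_le _ _ _).trans ?_
      have h1 := (hM ρ hρ1 ξ).2 hξ
      have h2 := hψ.norm_field_le α ht u (hρ.trans hlt.le)
      have h3 : ‖ξ‖ ^ (α - 2) ≤ ρ ^ (α - 2) :=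
        Real.rpow_le_rpow_of_nonpos hρ0 hlt.le (by linarith)
      have h4 : ‖field α ψ t u ξ‖ ≤ ρ ^ (α - 2) / t := h2.trans (by gcongr)
      gcongr
    · have : ρ ^ (α - 1) = ρ ^ (α - 2) * ρ := by
        rw [← Real.rpow_add_one hρ0.ne']; congr 1; ring
      rw [this]
      field_simp
  -- The smooth and sharp truncations differ only on the layer, where the integrand is at most
  -- `(2ρ)^α`.
  have hsharp : Tendsto (fun ρ : ℝ => (∫ ξ, (discCutoff ρ ξ : ℂ) * integrand α ψ t u ξ) -
      ∫ ξ in Metric.closedBall (0 : ℂ) ρ, integrand α ψ t u ξ) atTop (𝓝 0) := by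
    refine squeeze_zero_norm' ?_ (tendsto_const_mul_rpow_sub_one hα₁ (2 ^ α * Real.pi))
    filter_upwards [eventually_ge_atTop 1] with ρ hρ1
    have hρ0 : 0 < ρ := by linarith
    have hmeas := hψ.measurable_integrand α t u
    have hloc : IntegrableOn (integrand α ψ t u) (Metric.closedBall (0 : ℂ) (2 * ρ)) := by
      refine Measure.integrableOn_of_bounded (M := (2 * ρ) ^ α)
        (isCompact_closedBall (0 : ℂ) (2 * ρ)).measure_lt_top.ne
        hmeas.aestronglyMeasurable ?_
      filter_upwards [ae_restrict_mem measurableSet_closedBall] with ξ hξ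
      refine (hψ.norm_integrand_le α t u ξ).trans ?_
      exact Real.rpow_le_rpow (norm_nonneg _) (by simpa using hξ) hα₀
    have hcut : Integrable fun ξ => (discCutoff ρ ξ : ℂ) * integrand α ψ t u ξ := by
      have h1 : IntegrableOn (fun ξ => (discCutoff ρ ξ : ℂ) * integrand α ψ t u ξ)
          (Metric.closedBall (0 : ℂ) (2 * ρ)) :=
        hloc.bdd_mul (c := 1) (Complex.continuous_ofReal.comp
          (contDiff_discCutoff ρ).continuous).aestronglyMeasurable
          (Eventually.of_forall fun ξ => by
            have := discCutoff_mem_Icc ρ ξ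
            rw [Complex.norm_real, Real.norm_eq_abs, abs_of_nonneg this.1]
            exact this.2)
      refine (integrableOn_iff_integrable_of_support_subset ?_).1 h1
      intro ξ hξ
      rw [mem_closedBall_zero_iff]
      by_contra hc
      push Not at hc
      refine hξ ?_
      beta_reduce
      rw [discCutoff_eq_zero hρ0 (by linarith) fun h =>
        absurd (norm_le_of_mem_transitionLayer hρ1 h).2 (not_le.2 hc)]
      simp
    have hind : Integrable ((Metric.closedBall (0 : ℂ) ρ).indicator (integrand α ψ t u)) :=
      (hloc.mono_set (Metric.closedBall_subset_closedBall (by linarith))).integrable_indicator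
        measurableSet_closedBall
    rw [← integral_indicator measurableSet_closedBall, ← integral_sub hcut hind]
    refine (norm_integral_le_of_transitionLayer hρ0 (B := (2 * ρ) ^ α)
      (fun ξ hξ => ?_) (fun ξ hξ => ?_)).trans (le_of_eq ?_)
    · rcases le_or_gt ‖ξ‖ ρ with h | h
      · rw [indicator_of_mem (by simpa using h), discCutoff_eq_one hρ0 h]; simp
      · rw [indicator_of_notMem (by simpa using h), discCutoff_eq_zero hρ0 h hξ]; simp
    · have hb := norm_le_of_mem_transitionLayer hρ1 hξ
      have hm := discCutoff_mem_Icc ρ ξ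
      rw [indicator_of_notMem (by simpa using hb.1), sub_zero, norm_mul, Complex.norm_real,
        Real.norm_eq_abs, abs_of_nonneg hm.1]
      refine (mul_le_of_le_one_left (norm_nonneg _) hm.2).trans
        ((hψ.norm_integrand_le α t u ξ).trans ?_)
      exact Real.rpow_le_rpow (norm_nonneg _) hb.2 hα₀
    · rw [Real.mul_rpow two_pos.le hρ0.le, Real.rpow_sub_one hρ0.ne']
      ring
  have hsmooth : Tendsto (fun ρ : ℝ => ∫ ξ, (discCutoff ρ ξ : ℂ) * integrand α ψ t u ξ) atTop
      (𝓝 (∫ ξ, regularIntegrand α ψ t u ξ)) := by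
    have h := (tendsto_integral_discCutoff_mul hg).add hboundary
    rw [add_zero] at h
    refine h.congr' ?_
    filter_upwards [eventually_ge_atTop 1] with ρ hρ
    exact (integral_cutoff_mul_integrand hR hψ α ht u (contDiff_discCutoff ρ)
      (hasCompactSupport_discCutoff hρ) hg).symm
  have := hsmooth.sub hsharp
  simpa [HasOscillatoryIntegral] using this

theorem IsHighFrequencyCutoff.measurable_regularIntegrand {R : ℝ} (hR : 0 < R) {ψ : ℂ → ℝ}
    (hψ : IsHighFrequencyCutoff R ψ) (α : ℝ) {t : ℝ} (ht : 0 < t) (u : ℂ) :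
    Measurable (regularIntegrand α ψ t u) := by
  have h1 := measurable_oscillation t u
  have hdW := (hψ.contDiff_field hR α ht u).continuous_fderiv (by simp)
  have h2 : Measurable (divergence (field α ψ t u)) :=
    ((Complex.continuous_re.comp (hdW.clm_apply continuous_const)).add
      (Complex.continuous_im.comp (hdW.clm_apply continuous_const))).measurable
  have h3 : Measurable (amplitude α ψ) := by
    have := hψ.smooth.continuous.measurable
    unfold amplitude
    fun_prop
  have h4 : Measurable (denom t u) := by
    have hc : Measurable (fun z : ℂ => conj z) := Complex.continuous_conj.measurable
    unfold denom phaseGrad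
    fun_prop
  unfold regularIntegrand
  fun_prop

end NovikovVeselov

end

theorem proposition2p2 (R : ℝ) (hR : 2 < R) (ψ : ℂ → ℝ)
    (hψ : NovikovVeselov.IsHighFrequencyCutoff R ψ)
    (α : ℝ) (hα₀ : 0 ≤ α) (hα₁ : α < 1) (ε : ℝ) (hε₀ : 0 < ε) (hε₁ : ε < (1 - α) / 3) :
    ∃ C : ℝ, 0 < C ∧ ∀ t : ℝ, 0 < t → ∀ u : ℂ, ∃ J : ℂ,
      NovikovVeselov.HasOscillatoryIntegral (NovikovVeselov.integrand α ψ t u) J ∧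
        ‖J‖ ≤ C * (1 / t ^ (1 - ε)) := by
  open NovikovVeselov MeasureTheory in
  have hR0 : 0 < R := by linarith
  obtain ⟨K, hK0, hK⟩ := hψ.exists_norm_regularIntegrand_le hR hα₀ hα₁ hε₀ hε₁
  set k := kernel (2 - 2 * ε) (3 - α - 3 * ε) with hk
  have hki : Integrable k := integrable_kernel (by linarith) (by linarith)
  have hk0 : 0 ≤ ∫ ξ, k ξ := integral_nonneg fun ξ => kernel_nonneg _ _ ξ
  -- The 3 counts the translates of the kernel, all with the same integral; the 1 only secures
  -- strict positivity.
  refine ⟨K * (3 * ∫ ξ, k ξ) + 1, by positivity, fun t ht u => ?_⟩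
  obtain ⟨ζ, hζ⟩ := hK t ht u
  have hT : 0 < t ^ (1 - ε) := Real.rpow_pos_of_pos ht _
  have hbound : ∀ᵐ ξ : ℂ, ‖regularIntegrand α ψ t u ξ‖ ≤
      K * (1 / t ^ (1 - ε)) * (k ξ + k (ξ - ζ) + k (ξ + ζ)) := by
    filter_upwards [(Set.finite_singleton ζ).countable.ae_notMem volume,
      (Set.finite_singleton (-ζ)).countable.ae_notMem volume] with ξ h₁ h₂
    exact hζ ξ h₁ h₂
  have hi1 := hki.comp_sub_right ζ
  have hi2 := hki.comp_add_right ζ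
  have hi12 : Integrable fun ξ => k ξ + k (ξ - ζ) := hki.add hi1
  have hi : Integrable fun ξ => k ξ + k (ξ - ζ) + k (ξ + ζ) := hi12.add hi2
  have hg : Integrable (regularIntegrand α ψ t u) :=
    (hi.const_mul (K * (1 / t ^ (1 - ε)))).mono'
      (hψ.measurable_regularIntegrand hR0 α ht u).aestronglyMeasurable hbound
  refine ⟨_, hψ.hasOscillatoryIntegral hR0 hα₀ hα₁ ht u hg, ?_⟩
  refine (norm_integral_le_of_norm_le (hi.const_mul _) hbound).trans ?_
  rw [integral_const_mul, integral_add hi12 hi2, integral_add hki hi1,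
    integral_sub_right_eq_self k, integral_add_right_eq_self k]
  have : 0 < 1 / t ^ (1 - ε) := by positivity
  nlinarith
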